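/- Let $\mathbb{G}=(\mathbb{R}^n,\circ,\{\delta_R\})$ be a (homogeneous) Carnot group, with Lebesgue measure $\mathrm{d}x$, let $X_1,\dots,X_m$ be the left-invariant vector fields that agree at the origin with the coordinate fields of the first layer, and let $\nabla_0 u=\sum_{j}X_j(u)X_j$ (weak derivatives), where $\langle\,,\,\rangle$ is the metric on the first layer that makes $\{X_j\}$ orthonormal. Let $r$ be a symmetric homogeneous norm on $\mathbb{G}$, that is, a continuous function $r:\mathbb{G}\to[0,\infty)$ with $r(x)=0$ iff $x=0$, $r(\delta_R x)=R\,r(x)$ for $R>0$, and $r(x^{-1})=r(x)$. A function $u$ is Lipschitz on $U\subset\mathbb{G}$ if $u(x)-u(y)\le C\,r(x^{-1}\circ y)$ on $U$ for some constant $C$; $\mathrm{Lip}_{\mathrm{loc}}(\mathbb{G})$ and $\mathrm{Lip}_c(\mathbb{G})$ denote the locally Lipschitz functions and the compactly supported Lipschitz functions. Let $p>1$, let $\varphi\in C^0([0,\infty))$ satisfy $\varphi(0)=0$, $\varphi>0$ on $(0,\infty)$ and $\varphi(t)\le C_0t^{p-1}$ on $(0,\infty)$ for some constant $C_0>0$;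 let $b\in C^0(\mathbb{G})$ with $b>0$, $f\in C^0(\mathbb{R})$, and $l\in C^0([0,\infty))$ with $l(t)>0$ for $t>0$. A function $u\in\mathrm{Lip}_{\mathrm{loc}}(\mathbb{G})$ is a weak solution of $\Delta^\varphi_{\mathbb{G}}u\ge b(x)f(u)l(|\nabla_0u|)$ (resp. $\le$) on $\mathbb{G}$ if, for every $0\le\psi\in\mathrm{Lip}_c(\mathbb{G})$, $$\int_{\mathbb{G}}\frac{\varphi(|\nabla_0u|)}{|\nabla_0u|}\langle\nabla_0u,\nabla_0\psi\rangle\,\mathrm{d}x\le-\int_{\mathbb{G}}b(x)f(u)l(|\nabla_0u|)\,\psi\,\mathrm{d}x\qquad(\text{resp. }\ge),$$ and a weak solution of the equation if both hold. (The integrand on the left is understood to be $0$ where $\nabla_0u=0$.) Assume that, for some $\mu,\chi\in\mathbb{R}$ with $0\le\chi<p-1$ and $\mu<p-\chi$ and some constant $C>0$, $$b\ge C(1+r)^{-\mu}\ \text{on }\mathbb{G},\qquad f(t)\ge C\ \text{for } t \text{ large enough},\qquad l(t)\ge C\,\frac{\varphi(t)}{t^{p-1-\chi}}\ \text{for } t>0.$$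 Let $u\in\mathrm{Lip}_{\mathrm{loc}}(\mathbb{G})$ be non-constant, and put $u^*=\sup_{\mathbb{G}}u$, $u_*=\inf_{\mathbb{G}}u$, $u_+=\max\{u,0\}$. (1) If $u$ is a weak solution of $\Delta^\varphi_{\mathbb{G}}u\ge b(x)f(u)l(|\nabla_0u|)$ on $\mathbb{G}$ and $$u_+(x)=o\Big(r(x)^{\frac{p-\chi-\mu}{p-\chi-1}}\Big)\qquad\text{as } r(x)\to+\infty,$$ then $u$ is bounded above and $f(u^*)\le0$. (2) If $u$ is a weak solution of the equation $\Delta^\varphi_{\mathbb{G}}u=b(x)f(u)l(|\nabla_0u|)$ on $\mathbb{G}$, if for some constant $C_1>0$ one has $tf(t)\ge C_1|t|$ for $|t|$ large enough, and if $u(x)=o\big(r(x)^{\frac{p-\chi-\mu}{p-\chi-1}}\big)$ as $r(x)\to+\infty$, then $u\in L^\infty(\mathbb{G})$ and $f(u^*)\le0\le f(u_*)$. No restriction on the homogeneous dimension of $\mathbb{G}$ is imposed. -/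

import Mathlib

open MeasureTheory Filter Topology
open scoped ContDiff Asymptotics

/-- The Lie algebra closure (under brackets) of a family of vector fields on `ℝⁿ`. -/
inductive IsIteratedBracket {n : ℕ} {ι : Type} (X : ι → (Fin n → ℝ) → (Fin n → ℝ)) :
    ((Fin n → ℝ) → (Fin n → ℝ)) → Prop
  | base (j : ι) : IsIteratedBracket X (X j)
  | bracket (Y Z : (Fin n → ℝ) → (Fin n → ℝ)) :
      IsIteratedBracket X Y → IsIteratedBracket X Z →
        IsIteratedBracket X (VectorField.lieBracket ℝ Y Z)

/-- A Lie group structure on `ℝⁿ` with dilations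
`δ_R (x⁽¹⁾, …, x⁽ˢ⁾) = (R x⁽¹⁾, …, Rˢ x⁽ˢ⁾)` acting by group automorphisms;
`deg i` is the index of the layer that contains the coordinate `x i`. -/
structure HomogeneousLieGroup (n : ℕ) where
  deg : Fin n → ℕ
  one_le_deg : ∀ i, 1 ≤ deg i
  deg_mono : Monotone deg
  op : (Fin n → ℝ) → (Fin n → ℝ) → (Fin n → ℝ)
  inv : (Fin n → ℝ) → (Fin n → ℝ)
  op_assoc : ∀ x y z, op (op x y) z = op x (op y z)
  zero_op : ∀ x, op 0 x = x
  op_zero : ∀ x, op x 0 = x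
  inv_op : ∀ x, op (inv x) x = 0
  op_inv : ∀ x, op x (inv x) = 0
  contDiff_op : ContDiff ℝ ∞ (fun z : (Fin n → ℝ) × (Fin n → ℝ) => op z.1 z.2)
  contDiff_inv : ContDiff ℝ ∞ inv
  dil_op : ∀ R : ℝ, 0 < R → ∀ x y : Fin n → ℝ,
    op (fun i => R ^ deg i * x i) (fun i => R ^ deg i * y i) = fun i => R ^ deg i * op x y i

namespace HomogeneousLieGroup

variable {n : ℕ}

/-- The dilation `δ_R`. -/
def dil (G : HomogeneousLieGroup n) (R : ℝ) (x : Fin n → ℝ) : Fin n → ℝ :=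
  fun i => R ^ G.deg i * x i

/-- The indices of the coordinates of the first layer. -/
abbrev Hor (G : HomogeneousLieGroup n) : Type := {j : Fin n // G.deg j = 1}

/-- The left-invariant vector field `X_j` which equals `∂_j` at the origin: at `x` it is the image
of `∂_j` under the differential at the origin of the left translation `y ↦ x ∘ y`. -/
noncomputable def X (G : HomogeneousLieGroup n) (j : G.Hor) (x : Fin n → ℝ) : Fin n → ℝ :=
  fderiv ℝ (fun y => G.op x y) 0 (Pi.single j.1 1)

end HomogeneousLieGroup

/-- A homogeneous Carnot group `(ℝⁿ, ∘, {δ_R})`: a homogeneous Lie group whose Lie algebra is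
generated by the first layer. -/
structure CarnotGroup (n : ℕ) extends HomogeneousLieGroup n where
  generating : ∀ x : Fin n → ℝ, Submodule.span ℝ
    {v | ∃ Z, IsIteratedBracket toHomogeneousLieGroup.X Z ∧ Z x = v} = ⊤

namespace CarnotGroup

variable {n : ℕ}

/-- Symmetric homogeneous norms on a Carnot group. -/
structure IsHomogeneousNorm (G : CarnotGroup n) (r : (Fin n → ℝ) → ℝ) : Prop where
  continuous : Continuous r
  nonneg : ∀ x, 0 ≤ r x
  eq_zero_iff : ∀ x, r x = 0 ↔ x = 0
  dil : ∀ R : ℝ, 0 < R → ∀ x, r (G.dil R x) = R * r x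
  inv : ∀ x, r (G.inv x) = r x

/-- `u` is Lipschitz on `U`, with respect to the homogeneous norm `r`. -/
def IsLipOn (G : CarnotGroup n) (r : (Fin n → ℝ) → ℝ) (u : (Fin n → ℝ) → ℝ)
    (U : Set (Fin n → ℝ)) : Prop :=
  ∃ C : ℝ, 0 < C ∧ ∀ x ∈ U, ∀ y ∈ U, u x - u y ≤ C * r (G.op (G.inv x) y)

/-- The class `Lip_loc(𝔾)`. -/
def IsLipLoc (G : CarnotGroup n) (r : (Fin n → ℝ) → ℝ) (u : (Fin n → ℝ) → ℝ) : Prop :=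
  ∀ x, ∃ U ∈ 𝓝 x, G.IsLipOn r u U

/-- The class `Lip_c(𝔾)`. -/
def IsLipCompact (G : CarnotGroup n) (r : (Fin n → ℝ) → ℝ) (u : (Fin n → ℝ) → ℝ) : Prop :=
  G.IsLipOn r u Set.univ ∧ HasCompactSupport u

/-- `g` is the weak derivative `X_j u`. The field `X_j` is divergence free, so that its formal
adjoint is `-X_j`. -/
def IsWeakDeriv (G : CarnotGroup n) (j : G.Hor) (u g : (Fin n → ℝ) → ℝ) : Prop :=
  LocallyIntegrable u ∧ LocallyIntegrable g ∧
    ∀ η : (Fin n → ℝ) → ℝ, ContDiff ℝ ∞ η → HasCompactSupport η →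
      ∫ x, u x * fderiv ℝ η x (G.X j x) = - ∫ x, g x * η x

/-- `U` represents the horizontal gradient `∇₀u = ∑ⱼ X_j(u) X_j`, in the weak sense and in the
orthonormal frame `{X_j}`. It is unique up to null sets, and exists for `u ∈ Lip_loc(𝔾)`. -/
def IsWeakGrad (G : CarnotGroup n) (u : (Fin n → ℝ) → ℝ) (U : G.Hor → (Fin n → ℝ) → ℝ) : Prop :=
  ∀ j, G.IsWeakDeriv j u (U j)

/-- The length `|Y|` of the horizontal field with components `Y j` in the frame `{X_j}`. -/
noncomputable def horNorm (G : CarnotGroup n) (Y : G.Hor → (Fin n → ℝ) → ℝ)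
    (x : Fin n → ℝ) : ℝ :=
  √(∑ j, Y j x ^ 2)

/-- The inner product `⟨Y, Z⟩` of two horizontal fields. -/
noncomputable def horInner (G : CarnotGroup n) (Y Z : G.Hor → (Fin n → ℝ) → ℝ)
    (x : Fin n → ℝ) : ℝ :=
  ∑ j, Y j x * Z j x

/-- Weak solutions `u` of `Δ^φ_𝔾 u ≥ b(x) f(u) l(|∇₀u|)` on `𝔾`, with test functions
`0 ≤ ψ ∈ Lip_c(𝔾)`. -/
def IsWeakSolGE (G : CarnotGroup n) (r : (Fin n → ℝ) → ℝ) (φ : ℝ → ℝ) (b : (Fin n → ℝ) → ℝ)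
    (f l : ℝ → ℝ) (u : (Fin n → ℝ) → ℝ) : Prop :=
  ∃ U, G.IsWeakGrad u U ∧
    ∀ ψ Ψ, G.IsLipCompact r ψ → (∀ x, 0 ≤ ψ x) → G.IsWeakGrad ψ Ψ →
      ∫ x, φ (G.horNorm U x) / G.horNorm U x * G.horInner U Ψ x
        ≤ - ∫ x, b x * f (u x) * l (G.horNorm U x) * ψ x

/-- Weak solutions `u` of `Δ^φ_𝔾 u ≤ b(x) f(u) l(|∇₀u|)` on `𝔾`. -/
def IsWeakSolLE (G : CarnotGroup n) (r : (Fin n → ℝ) → ℝ) (φ : ℝ → ℝ) (b : (Fin n → ℝ) → ℝ)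
    (f l : ℝ → ℝ) (u : (Fin n → ℝ) → ℝ) : Prop :=
  ∃ U, G.IsWeakGrad u U ∧
    ∀ ψ Ψ, G.IsLipCompact r ψ → (∀ x, 0 ≤ ψ x) → G.IsWeakGrad ψ Ψ →
      - ∫ x, b x * f (u x) * l (G.horNorm U x) * ψ x
        ≤ ∫ x, φ (G.horNorm U x) / G.horNorm U x * G.horInner U Ψ x

/-- Weak solutions `u` of `Δ^φ_𝔾 u = b(x) f(u) l(|∇₀u|)` on `𝔾`. -/
def IsWeakSolEq (G : CarnotGroup n) (r : (Fin n → ℝ) → ℝ) (φ : ℝ → ℝ) (b : (Fin n → ℝ) → ℝ)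
    (f l : ℝ → ℝ) (u : (Fin n → ℝ) → ℝ) : Prop :=
  G.IsWeakSolGE r φ b f l u ∧ G.IsWeakSolLE r φ b f l u

end CarnotGroup

/-!
The proof tests the differential inequality with `ψ = η ^ (q + 1) * v ^ 2`, where `v = (u - γ)₊`
for a level `γ` above which `f (u)` is at least a positive constant, and `η` is a cutoff between the
balls of radius `R` and `c R`. Writing `X = |∇₀u|` and
`E = 2 v φ(X) X + b f(u) l(X) v² ≥ 0`, this bounds `∫ η ^ (q + 1) E` by an integral of
`η ^ q v² φ(X) / R` over the annulus `R ≤ r ≤ c R` (`CarnotGroup.integral_mul_energy_le`,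
`CarnotGroup.exists_cutoff`). The right-hand side is estimated in two ways.

* As `l(X) ≥ C φ(X) X ^ (-s)` with `s = p - 1 - χ > 0`, the first term of `E` dominates the error
  where `X` is large compared with `v / R`, and the second one where `X` is small. The two regimes
  match exactly when `v = o(R ^ ((1 + s - μ) / s))` (`exists_absorb`), so that for every `θ > 0` one
  has `J(R) ≤ θ J(c R)` for large `R`, where `J(R) = ∫_{r ≤ R} E`.
* As `φ(t) ≤ C₀ t ^ (p - 1)`, a Caccioppoli argument (`le_add_of_rpow_le`) and the polynomial
  volume growth of balls show that `J` grows at most polynomially.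

Together they force `J = 0` (`eq_zero_of_le_mul_of_le_rpow`). Thus `∇₀ (v²) = 0`, so `v` is
constant and, `u` being non-constant, `u ≤ γ` (`CarnotGroup.le_of_isWeakSolGE`). A large `γ` gives
the boundedness of `u`; if `f (sup u)` were positive, some `γ < sup u` would be admissible as well,
which is absurd. The second part applies the first one to `u` and to `-u`.

The calculus of weak horizontal derivatives rests on the difference quotients
`(u (x ∘ s e_j) - u x) / s`. Right translations preserve Lebesgue measure, because their Jacobian
determinant is invariant under dilations (`HomogeneousLieGroup.det_fderiv_op_left`); hence these
quotients converge to the weak derivative in the sense of distributions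
(`CarnotGroup.tendsto_integral_diffQuot`). For locally Lipschitz `u` they are locally bounded, which
yields local boundedness of the weak gradient and the chain rule. A continuous function with zero
horizontal gradient is constant: its averages over left translates are smooth and annihilated by the
`X_j`, hence by all their brackets, which span every tangent space.
-/

namespace HomogeneousLieGroup

variable {n : ℕ}

/-! ### Dilations, left-invariant fields and right translations -/

/-- The dilation `δ_R` as a continuous linear map. -/
noncomputable def dilL (G : HomogeneousLieGroup n) (R : ℝ) : (Fin n → ℝ) →L[ℝ] (Fin n → ℝ) :=
  ContinuousLinearMap.pi fun i => R ^ G.deg i • ContinuousLinearMap.proj i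

theorem dilL_apply (G : HomogeneousLieGroup n) (R : ℝ) (x : Fin n → ℝ) :
    G.dilL R x = G.dil R x := by
  ext i; simp [dilL, dil]

theorem dil_op' (G : HomogeneousLieGroup n) {R : ℝ} (hR : 0 < R) (x y : Fin n → ℝ) :
    G.dil R (G.op x y) = G.op (G.dil R x) (G.dil R y) :=
  (G.dil_op R hR x y).symm

theorem dil_dil (G : HomogeneousLieGroup n) (R S : ℝ) (x : Fin n → ℝ) :
    G.dil R (G.dil S x) = G.dil (R * S) x := by
  ext i; simp [dil, mul_pow, mul_assoc]

theorem dil_one (G : HomogeneousLieGroup n) (x : Fin n → ℝ) : G.dil 1 x = x := by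
  ext i; simp [dil]

theorem dil_inv_dil (G : HomogeneousLieGroup n) {R : ℝ} (hR : 0 < R) (x : Fin n → ℝ) :
    G.dil R (G.dil R⁻¹ x) = x := by
  rw [dil_dil, mul_inv_cancel₀ hR.ne', dil_one]

theorem continuous_dil_left (G : HomogeneousLieGroup n) (x : Fin n → ℝ) :
    Continuous fun R => G.dil R x := by
  unfold dil; fun_prop

theorem dil_zero_left (G : HomogeneousLieGroup n) (x : Fin n → ℝ) : G.dil 0 x = 0 := by
  ext i; have := G.one_le_deg i; simp [dil]; left; omega

theorem tendsto_dil_zero (G : HomogeneousLieGroup n) (x : Fin n → ℝ) :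
    Tendsto (fun R => G.dil R x) (𝓝[>] 0) (𝓝 0) := by
  have := (G.continuous_dil_left x).tendsto 0
  rw [G.dil_zero_left] at this
  exact this.mono_left nhdsWithin_le_nhds

theorem continuous_op (G : HomogeneousLieGroup n) :
    Continuous fun z : (Fin n → ℝ) × (Fin n → ℝ) => G.op z.1 z.2 := G.contDiff_op.continuous

theorem continuous_inv (G : HomogeneousLieGroup n) : Continuous G.inv := G.contDiff_inv.continuous

theorem contDiff_op_right (G : HomogeneousLieGroup n) (x : Fin n → ℝ) :
    ContDiff ℝ ∞ (fun y => G.op x y) :=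
  G.contDiff_op.comp (contDiff_const.prodMk contDiff_id)

theorem contDiff_op_left (G : HomogeneousLieGroup n) (y : Fin n → ℝ) :
    ContDiff ℝ ∞ (fun x => G.op x y) :=
  G.contDiff_op.comp (contDiff_id.prodMk contDiff_const)

theorem inv_op_cancel (G : HomogeneousLieGroup n) (x y : Fin n → ℝ) :
    G.op (G.inv x) (G.op x y) = y := by rw [← G.op_assoc, G.inv_op, G.zero_op]

theorem op_inv_cancel (G : HomogeneousLieGroup n) (x y : Fin n → ℝ) :
    G.op x (G.op (G.inv x) y) = y := by rw [← G.op_assoc, G.op_inv, G.zero_op]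

theorem op_op_inv (G : HomogeneousLieGroup n) (x y : Fin n → ℝ) :
    G.op (G.op x y) (G.inv y) = x := by rw [G.op_assoc, G.op_inv, G.op_zero]

theorem op_inv_op (G : HomogeneousLieGroup n) (x y : Fin n → ℝ) :
    G.op (G.op x (G.inv y)) y = x := by rw [G.op_assoc, G.inv_op, G.op_zero]

theorem inv_zero (G : HomogeneousLieGroup n) : G.inv 0 = 0 := by
  have := G.inv_op 0; rwa [G.op_zero] at this

theorem inv_op_rev (G : HomogeneousLieGroup n) (x y : Fin n → ℝ) :
    G.inv (G.op (G.inv x) y) = G.op (G.inv y) x := by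
  have h : G.op (G.op (G.inv x) y) (G.op (G.inv y) x) = 0 := by
    rw [G.op_assoc, G.op_inv_cancel, G.inv_op]
  have := G.inv_op_cancel (G.op (G.inv x) y) (G.op (G.inv y) x)
  rw [h, G.op_zero] at this
  exact this

/-- The point `s e_j` on the `j`-th coordinate axis. -/
noncomputable def axis (G : HomogeneousLieGroup n) (j : G.Hor) (s : ℝ) : Fin n → ℝ :=
  s • Pi.single j.1 1

theorem dil_axis (G : HomogeneousLieGroup n) (j : G.Hor) (R s : ℝ) :
    G.dil R (G.axis j s) = G.axis j (R * s) := by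
  ext i
  by_cases h : i = j.1
  · subst h; simp [dil, axis, j.2]
  · simp [dil, axis, h]

theorem continuous_axis (G : HomogeneousLieGroup n) (j : G.Hor) : Continuous (G.axis j) := by
  unfold axis; fun_prop

theorem axis_zero (G : HomogeneousLieGroup n) (j : G.Hor) : G.axis j 0 = 0 := by simp [axis]

theorem hasDerivAt_axis (G : HomogeneousLieGroup n) (j : G.Hor) (s : ℝ) :
    HasDerivAt (G.axis j) (Pi.single j.1 1) s := by
  have h := (hasDerivAt_id s).smul_const (Pi.single j.1 (1 : ℝ) : Fin n → ℝ)
  rw [one_smul] at h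
  exact h

/-- Differentiating `F` along `s ↦ x ∘ s e_j` at `s = 0` gives `X_j F (x)`. -/
theorem hasDerivAt_comp_op_axis (G : HomogeneousLieGroup n) (j : G.Hor) (x : Fin n → ℝ)
    {F : (Fin n → ℝ) → ℝ} (hF : DifferentiableAt ℝ F x) :
    HasDerivAt (fun s => F (G.op x (G.axis j s))) (fderiv ℝ F x (G.X j x)) 0 := by
  have h1 : HasFDerivAt (fun y => G.op x y) (fderiv ℝ (fun y => G.op x y) 0) (G.axis j 0) := by
    rw [axis_zero]
    exact ((G.contDiff_op_right x).differentiable (by simp) 0).hasFDerivAt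
  have h2 := h1.comp_hasDerivAt (0 : ℝ) (G.hasDerivAt_axis j 0)
  have h3 : HasFDerivAt F (fderiv ℝ F x) (G.op x (G.axis j 0)) := by
    rw [axis_zero, G.op_zero]; exact hF.hasFDerivAt
  exact h3.comp_hasDerivAt (0 : ℝ) h2

theorem contDiff_X (G : HomogeneousLieGroup n) (j : G.Hor) : ContDiff ℝ ∞ (G.X j) := by
  unfold X
  have : ContDiff ℝ ∞ (fun x : Fin n → ℝ => fderiv ℝ (fun y => G.op x y) 0) :=
    ContDiff.fderiv (n := ∞) (f := fun x y => G.op x y) (g := fun _ => 0) G.contDiff_op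
      contDiff_const (by simp)
  exact this.clm_apply contDiff_const

/-- The fields `X_j` are homogeneous of degree one with respect to the dilations. -/
theorem X_dil (G : HomogeneousLieGroup n) (j : G.Hor) {R : ℝ} (hR : 0 < R) (x : Fin n → ℝ) :
    G.dil R (G.X j x) = R • G.X j (G.dil R x) := by
  have h1 : HasDerivAt (fun s => G.op (G.dil R x) (G.axis j (R * s)))
      (R • G.X j (G.dil R x)) 0 := by
    have h1 : HasFDerivAt (fun y => G.op (G.dil R x) y)
        (fderiv ℝ (fun y => G.op (G.dil R x) y) 0) (G.axis j (R * 0)) := by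
      rw [mul_zero, axis_zero]
      exact ((G.contDiff_op_right _).differentiable (by simp) 0).hasFDerivAt
    have h2 : HasDerivAt (fun s : ℝ => G.axis j (R * s)) (R • Pi.single j.1 1) 0 := by
      have := (G.hasDerivAt_axis j (R * 0)).scomp (0 : ℝ) ((hasDerivAt_id (0 : ℝ)).const_mul R)
      rw [mul_one] at this
      exact this
    have := h1.comp_hasDerivAt (0 : ℝ) h2
    rw [map_smul] at this
    exact this
  have h2 : HasDerivAt (fun s => G.dilL R (G.op x (G.axis j s))) (G.dilL R (G.X j x)) 0 := by
    have h1 : HasFDerivAt (fun y => G.op x y) (fderiv ℝ (fun y => G.op x y) 0) (G.axis j 0) := by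
      rw [axis_zero]
      exact ((G.contDiff_op_right x).differentiable (by simp) 0).hasFDerivAt
    have h2 := h1.comp_hasDerivAt (0 : ℝ) (G.hasDerivAt_axis j 0)
    exact (G.dilL R).hasFDerivAt.comp_hasDerivAt (0 : ℝ) h2
  simp only [dilL_apply, G.dil_op' hR, dil_axis] at h2
  exact h2.unique h1

/-- Right translations have Jacobian determinant `1`: the determinant is invariant under the
simultaneous dilation of both variables, hence equals its value at the origin. -/
theorem det_fderiv_op_left (G : HomogeneousLieGroup n) (a x : Fin n → ℝ) :
    (fderiv ℝ (fun z => G.op z a) x).det = 1 := by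
  let J : (Fin n → ℝ) × (Fin n → ℝ) → ℝ := fun q => (fderiv ℝ (fun z => G.op z q.1) q.2).det
  have hJ : Continuous J := by
    have h : Continuous fun q : (Fin n → ℝ) × (Fin n → ℝ) =>
        fderiv ℝ (fun z => G.op z q.1) q.2 := by
      refine (ContDiff.fderiv (m := ∞) (n := 0)
        (f := fun (q : (Fin n → ℝ) × (Fin n → ℝ)) z => G.op z q.1) (g := fun q => q.2)
        ?_ contDiff_snd (by simp)).continuous
      exact G.contDiff_op.comp (contDiff_snd.prodMk (contDiff_fst.comp contDiff_fst))
    exact ContinuousLinearMap.continuous_det.comp h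
  have hinv : ∀ R : ℝ, 0 < R → J (G.dil R a, G.dil R x) = J (a, x) := by
    intro R hR
    have hd : ∀ a x, HasFDerivAt (fun z => G.op z a) (fderiv ℝ (fun z => G.op z a) x) x :=
      fun a x => ((G.contDiff_op_left a).differentiable (by simp) x).hasFDerivAt
    have h1 : HasFDerivAt (fun z => G.dilL R (G.op z a))
        ((G.dilL R).comp (fderiv ℝ (fun z => G.op z a) x)) x :=
      (G.dilL R).hasFDerivAt.comp x (hd a x)
    have h2 : HasFDerivAt (fun z => G.op (G.dilL R z) (G.dil R a))
        ((fderiv ℝ (fun z => G.op z (G.dil R a)) (G.dil R x)).comp (G.dilL R)) x := by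
      have := hd (G.dil R a) (G.dilL R x)
      rw [dilL_apply] at this
      exact HasFDerivAt.comp x (by rw [dilL_apply]; exact this) (G.dilL R).hasFDerivAt
    simp only [dilL_apply, G.dil_op' hR] at h1 h2
    have h3 := congrArg ContinuousLinearMap.det (h1.unique h2)
    have hne : (G.dilL R).det ≠ 0 := by
      have h4 : (G.dilL R).comp (G.dilL R⁻¹) = ContinuousLinearMap.id ℝ _ := by
        ext1 y; simp [dilL_apply, G.dil_inv_dil hR]
      have h5 := congrArg (fun A : (Fin n → ℝ) →L[ℝ] (Fin n → ℝ) => A.det) h4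
      simp only [ContinuousLinearMap.det, ContinuousLinearMap.toLinearMap_comp,
        LinearMap.det_comp] at h5
      intro h0
      simp only [ContinuousLinearMap.det] at h0
      rw [h0] at h5; simp at h5
    simp only [ContinuousLinearMap.det, ContinuousLinearMap.toLinearMap_comp,
        LinearMap.det_comp] at h3 hne
    rw [mul_comm] at h3
    exact (mul_right_cancel₀ hne h3).symm
  have hlim : Tendsto (fun R => J (G.dil R a, G.dil R x)) (𝓝[>] 0) (𝓝 (J (0, 0))) :=
    (hJ.tendsto (0, 0)).comp ((G.tendsto_dil_zero a).prodMk_nhds (G.tendsto_dil_zero x))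
  have hlim2 : Tendsto (fun R => J (G.dil R a, G.dil R x)) (𝓝[>] 0) (𝓝 (J (a, x))) :=
    tendsto_const_nhds.congr' (by
      filter_upwards [self_mem_nhdsWithin] with R hR using (hinv R hR).symm)
  have h0 : J (0, 0) = 1 := by
    have : (fun z => G.op z 0) = id := by ext1 z; exact G.op_zero z
    simp only [J, this, fderiv_id]
    simp [ContinuousLinearMap.det]
  exact (tendsto_nhds_unique hlim2 hlim).trans h0

theorem measurePreserving_op_left (G : HomogeneousLieGroup n) (a : Fin n → ℝ) :
    MeasurePreserving (fun z => G.op z a) := by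
  refine ⟨(G.contDiff_op_left a).continuous.measurable, ?_⟩
  have hinj : Set.InjOn (fun z => G.op z a) Set.univ := fun x _ y _ h => by
    have := congrArg (fun z => G.op z (G.inv a)) h
    simpa only [G.op_op_inv] using this
  ext s hs
  rw [Measure.map_apply (G.contDiff_op_left a).continuous.measurable hs]
  have hs' : MeasurableSet ((fun z => G.op z a) ⁻¹' s) :=
    (G.contDiff_op_left a).continuous.measurable hs
  have h := lintegral_image_eq_lintegral_abs_det_fderiv_mul volume hs'
    (f := fun z => G.op z a) (f' := fun x => fderiv ℝ (fun z => G.op z a) x)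
    (fun x _ => ((G.contDiff_op_left a).differentiable (by simp) x).hasFDerivAt.hasFDerivWithinAt)
    (hinj.mono (Set.subset_univ _)) (fun _ => 1)
  have himg : (fun z => G.op z a) '' ((fun z => G.op z a) ⁻¹' s) = s :=
    Set.image_preimage_eq s fun y => ⟨G.op y (G.inv a), G.op_inv_op y a⟩
  rw [himg] at h
  simpa [det_fderiv_op_left] using h.symm

theorem measurableEmbedding_op_left (G : HomogeneousLieGroup n) (a : Fin n → ℝ) :
    MeasurableEmbedding (fun z => G.op z a) :=
  (Homeomorph.mk ⟨fun z => G.op z a, fun z => G.op z (G.inv a), fun z => G.op_op_inv z a,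
    fun z => G.op_inv_op z a⟩ (G.contDiff_op_left a).continuous
    (G.contDiff_op_left _).continuous).measurableEmbedding

theorem integral_op_left (G : HomogeneousLieGroup n) (a : Fin n → ℝ) (F : (Fin n → ℝ) → ℝ) :
    ∫ x, F (G.op x a) = ∫ x, F x :=
  (G.measurePreserving_op_left a).integral_comp (G.measurableEmbedding_op_left a) F

end HomogeneousLieGroup

namespace CarnotGroup

variable {n : ℕ} {G : CarnotGroup n} {r : (Fin n → ℝ) → ℝ}

/-! ### Homogeneous norms -/

namespace IsHomogeneousNorm

theorem apply_zero (hr : G.IsHomogeneousNorm r) : r 0 = 0 := (hr.eq_zero_iff 0).2 rfl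

/-- The balls of a homogeneous norm are contained in the dilates of the unit cube: the norm has a
positive minimum `m` on the Euclidean unit sphere, and a point outside the unit cube is moved onto
that sphere by a contracting dilation. -/
theorem exists_abs_coord_le (hr : G.IsHomogeneousNorm r) :
    ∃ m : ℝ, 0 < m ∧ ∀ R : ℝ, 0 < R → ∀ x, r x < m * R → ∀ i, |x i| ≤ R ^ G.deg i := by
  obtain ⟨m, hm, hmS⟩ := (isCompact_sphere (0 : Fin n → ℝ) 1).exists_forall_le' (a := (0 : ℝ))
    hr.continuous.continuousOn (fun x hx => lt_of_le_of_ne (hr.nonneg x) fun h => by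
      rw [eq_comm, hr.eq_zero_iff] at h; subst h; simp at hx)
  have key : ∀ x, r x < m → ‖x‖ < 1 := by
    intro x hx
    by_contra! h1
    have hc : ContinuousOn (fun R : ℝ => ‖G.dil R x‖) (Set.Icc 0 1) :=
      (G.continuous_dil_left x).norm.continuousOn
    obtain ⟨R, hR, hR1⟩ := intermediate_value_Icc zero_le_one hc
      (show (1 : ℝ) ∈ Set.Icc _ _ by simp [G.dil_zero_left, G.dil_one, h1])
    have hR0 : 0 < R := lt_of_le_of_ne hR.1 fun h => by
      subst h; simp [G.dil_zero_left] at hR1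
    have h2 := hmS (G.dil R x) (by simpa using hR1)
    rw [hr.dil R hR0] at h2
    nlinarith [hR.2, hr.nonneg x]
  refine ⟨m, hm, fun R hR x hx i => ?_⟩
  have h1 : ‖G.dil R⁻¹ x‖ < 1 := key _ (by
    rw [hr.dil _ (inv_pos.2 hR), inv_mul_lt_iff₀ hR]; linarith)
  have h2 := (norm_le_pi_norm (G.dil R⁻¹ x) i).trans h1.le
  simp only [HomogeneousLieGroup.dil, Real.norm_eq_abs, abs_mul, inv_pow, abs_inv, abs_pow,
    abs_of_pos hR] at h2
  rwa [inv_mul_le_iff₀ (by positivity), mul_one] at h2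

theorem exists_norm_le (hr : G.IsHomogeneousNorm r) :
    ∃ m : ℝ, 0 < m ∧ ∀ x, r x < m → ‖x‖ ≤ r x / m := by
  obtain ⟨m, hm, h⟩ := hr.exists_abs_coord_le
  refine ⟨m, hm, fun x hx => ?_⟩
  have hx1 : r x / m < 1 := (div_lt_one hm).2 hx
  have h0 : 0 ≤ r x / m := div_nonneg (hr.nonneg x) hm.le
  refine le_of_forall_gt_imp_ge_of_dense fun R hR => ?_
  have hmin : r x / m < min R 1 := lt_min hR hx1
  refine le_trans ?_ (min_le_left R 1)
  have hpos : 0 < min R 1 := h0.trans_lt hmin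
  refine (pi_norm_le_iff_of_nonneg hpos.le).2 fun i => ?_
  refine (h _ hpos x (by rwa [div_lt_iff₀' hm] at hmin) i).trans ?_
  calc min R 1 ^ G.deg i ≤ min R 1 ^ 1 :=
        pow_le_pow_of_le_one hpos.le (min_le_right _ _) (G.one_le_deg i)
    _ = min R 1 := pow_one _

theorem exists_lt_imp_mem (hr : G.IsHomogeneousNorm r) {N : Set (Fin n → ℝ)} (hN : N ∈ 𝓝 0) :
    ∃ δ : ℝ, 0 < δ ∧ ∀ z, r z < δ → z ∈ N := by
  obtain ⟨m, hm, h⟩ := hr.exists_norm_le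
  obtain ⟨ε, hε, hN⟩ := Metric.mem_nhds_iff.1 hN
  refine ⟨min m (m * ε), by positivity, fun z hz => hN ?_⟩
  rw [mem_ball_zero_iff]
  refine (h z (hz.trans_le (min_le_left _ _))).trans_lt ?_
  rw [div_lt_iff₀' hm]
  exact hz.trans_le (min_le_right _ _)

theorem exists_norm_le_pow (hr : G.IsHomogeneousNorm r) :
    ∃ (a : ℝ) (D : ℕ), 0 < a ∧ ∀ R : ℝ, 1 ≤ R → ∀ x, r x ≤ R → ‖x‖ ≤ (a * R) ^ D := by
  obtain ⟨m, hm, h⟩ := hr.exists_abs_coord_le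
  have ha : 1 ≤ max 1 (2 / m) := le_max_left _ _
  refine ⟨max 1 (2 / m), ∑ i, G.deg i, by positivity, fun R hR x hx => ?_⟩
  have hb : 1 ≤ max 1 (2 / m) * R := one_le_mul_of_one_le_of_one_le ha hR
  refine (pi_norm_le_iff_of_nonneg (by positivity)).2 fun i => ?_
  refine (h (max 1 (2 / m) * R) (by positivity) x ?_ i).trans ?_
  · have : 2 ≤ m * max 1 (2 / m) := by
      rw [← div_le_iff₀' hm]; exact le_max_right _ _
    nlinarith
  · exact pow_le_pow_right₀ hb (Finset.single_le_sum (fun i _ => Nat.zero_le (G.deg i))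
      (Finset.mem_univ i))

theorem isCompact_le (hr : G.IsHomogeneousNorm r) (R : ℝ) : IsCompact {x | r x ≤ R} := by
  obtain ⟨a, D, -, h⟩ := hr.exists_norm_le_pow
  refine (isCompact_closedBall (0 : Fin n → ℝ) ((a * max R 1) ^ D)).of_isClosed_subset
    (isClosed_le hr.continuous continuous_const) fun x hx => ?_
  rw [mem_closedBall_zero_iff]
  exact h _ (le_max_right _ _) x (le_trans hx (le_max_left _ _))

/-- The balls of a homogeneous norm have polynomial volume growth. -/
theorem exists_volume_le (hr : G.IsHomogeneousNorm r) :
    ∃ (a : ℝ) (D : ℕ), 0 < a ∧ ∀ R : ℝ, 1 ≤ R →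
      volume.real {x : Fin n → ℝ | r x ≤ R} ≤ a * R ^ D := by
  obtain ⟨a, D, ha, h⟩ := hr.exists_norm_le_pow
  refine ⟨(2 * a ^ D) ^ n, D * n, by positivity, fun R hR => ?_⟩
  calc volume.real {x | r x ≤ R} ≤ volume.real (Metric.closedBall (0 : Fin n → ℝ) ((a * R) ^ D)) :=
        measureReal_mono (fun x hx => by rw [mem_closedBall_zero_iff]; exact h R hR x hx)
          (isCompact_closedBall _ _).measure_lt_top.ne
    _ = (2 * (a * R) ^ D) ^ n := by
        rw [Measure.real, Real.volume_pi_closedBall _ (by positivity),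
          ENNReal.toReal_ofReal (by positivity), Fintype.card_fin]
    _ = _ := by rw [mul_pow a, ← mul_assoc, mul_pow (2 * a ^ D), ← pow_mul]

theorem axis (hr : G.IsHomogeneousNorm r) (j : G.Hor) {s : ℝ} (hs : 0 < s) :
    r (G.axis j s) = s * r (G.axis j 1) := by
  rw [← hr.dil s hs, G.dil_axis, mul_one]

theorem inv_op_comm (hr : G.IsHomogeneousNorm r) (x y : Fin n → ℝ) :
    r (G.op (G.inv y) x) = r (G.op (G.inv x) y) := by
  rw [← hr.inv, G.inv_op_rev]

end IsHomogeneousNorm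

/-! ### Lipschitz functions -/

theorem IsLipOn.exists_abs_le (hr : G.IsHomogeneousNorm r) {u : (Fin n → ℝ) → ℝ}
    {U : Set (Fin n → ℝ)} (h : G.IsLipOn r u U) :
    ∃ C : ℝ, 0 < C ∧ ∀ x ∈ U, ∀ y ∈ U, |u x - u y| ≤ C * r (G.op (G.inv x) y) := by
  obtain ⟨C, hC, h⟩ := h
  refine ⟨C, hC, fun x hx y hy => abs_sub_le_iff.2 ⟨h x hx y hy, ?_⟩⟩
  have := h y hy x hx
  rwa [hr.inv_op_comm] at this

theorem continuous_inv_op (G : CarnotGroup n) :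
    Continuous fun q : (Fin n → ℝ) × (Fin n → ℝ) => G.op (G.inv q.1) q.2 :=
  G.continuous_op.comp ((G.continuous_inv.comp continuous_fst).prodMk continuous_snd)

theorem IsLipLoc.continuous (hr : G.IsHomogeneousNorm r) {u : (Fin n → ℝ) → ℝ}
    (hu : G.IsLipLoc r u) : Continuous u := by
  refine continuous_iff_continuousAt.2 fun x => ?_
  obtain ⟨U, hU, h⟩ := hu x
  obtain ⟨C, hC, h⟩ := h.exists_abs_le hr
  have hxU := mem_of_mem_nhds hU
  refine tendsto_iff_norm_sub_tendsto_zero.2 (squeeze_zero' (g := fun y => C * r (G.op (G.inv y) x))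
    (Eventually.of_forall fun _ => norm_nonneg _) ?_ ?_)
  · filter_upwards [hU] with y hy using h y hy x hxU
  · have h1 : Continuous fun y => C * r (G.op (G.inv y) x) :=
      continuous_const.mul (hr.continuous.comp
        (G.continuous_inv_op.comp (continuous_id.prodMk continuous_const)))
    have := h1.tendsto x
    rwa [G.inv_op, hr.apply_zero, mul_zero] at this

/-- On a compact set a locally Lipschitz function is Lipschitz at a uniform scale. -/
theorem IsLipLoc.exists_abs_le_of_isCompact (hr : G.IsHomogeneousNorm r) {u : (Fin n → ℝ) → ℝ}
    (hu : G.IsLipLoc r u) {K : Set (Fin n → ℝ)} (hK : IsCompact K) :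
    ∃ M : ℝ, 0 < M ∧ ∃ δ : ℝ, 0 < δ ∧ ∀ x ∈ K, ∀ y, r (G.op (G.inv x) y) < δ →
      |u x - u y| ≤ M * r (G.op (G.inv x) y) := by
  refine hK.induction_on ⟨1, one_pos, 1, one_pos, fun x hx => hx.elim⟩ ?_ ?_ ?_
  · rintro s t hst ⟨M, hM, δ, hδ, h⟩
    exact ⟨M, hM, δ, hδ, fun x hx => h x (hst hx)⟩
  · rintro s t ⟨M, hM, δ, hδ, h⟩ ⟨M', hM', δ', hδ', h'⟩
    refine ⟨max M M', lt_max_of_lt_left hM, min δ δ', lt_min hδ hδ', fun x hx y hy => ?_⟩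
    have hr0 := hr.nonneg (G.op (G.inv x) y)
    rcases hx with hx | hx
    · exact (h x hx y (hy.trans_le (min_le_left _ _))).trans (by gcongr; exact le_max_left _ _)
    · exact (h' x hx y (hy.trans_le (min_le_right _ _))).trans (by gcongr; exact le_max_right _ _)
  · intro x hx
    obtain ⟨U, hU, h⟩ := hu x
    obtain ⟨C, hC, h⟩ := h.exists_abs_le hr
    have h1 : ∀ᶠ q : (Fin n → ℝ) × (Fin n → ℝ) in 𝓝 x ×ˢ 𝓝 0, G.op q.1 q.2 ∈ U := by
      rw [← nhds_prod_eq]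
      refine G.continuous_op.continuousAt.eventually_mem ?_
      rwa [G.op_zero]
    obtain ⟨t, ht, N, hN, htN⟩ := Filter.mem_prod_iff.1 h1
    obtain ⟨δ, hδ, hδN⟩ := hr.exists_lt_imp_mem hN
    refine ⟨t ∩ U, mem_nhdsWithin_of_mem_nhds (inter_mem ht hU), C, hC, δ, hδ,
      fun x' hx' y hy => h x' hx'.2 y ?_⟩
    have := htN (Set.mk_mem_prod hx'.1 (hδN _ hy))
    simpa [G.op_inv_cancel] using this

theorem IsLipLoc.isLipOn_univ (hr : G.IsHomogeneousNorm r) {u : (Fin n → ℝ) → ℝ}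
    (hu : G.IsLipLoc r u) (hc : HasCompactSupport u) : G.IsLipOn r u Set.univ := by
  obtain ⟨M, hM, δ, hδ, h⟩ := hu.exists_abs_le_of_isCompact hr hc
  obtain ⟨B, hB⟩ := (hu.continuous hr).bounded_above_of_compact_support hc
  have hB0 : 0 ≤ B := (norm_nonneg _).trans (hB 0)
  refine ⟨M + 2 * B / δ, by positivity, fun x _ y _ => ?_⟩
  have hr0 := hr.nonneg (G.op (G.inv x) y)
  have hle : M * r (G.op (G.inv x) y) ≤ (M + 2 * B / δ) * r (G.op (G.inv x) y) := by
    gcongr; linarith [show 0 ≤ 2 * B / δ by positivity]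
  by_cases hxy : r (G.op (G.inv x) y) < δ
  · by_cases hx : x ∈ tsupport u
    · exact (le_abs_self _).trans ((h x hx y hxy).trans hle)
    by_cases hy : y ∈ tsupport u
    · have := h y hy x (by rwa [hr.inv_op_comm])
      rw [hr.inv_op_comm, abs_sub_comm] at this
      exact (le_abs_self _).trans (this.trans hle)
    rw [image_eq_zero_of_notMem_tsupport hx, image_eq_zero_of_notMem_tsupport hy]
    simp only [sub_zero]; positivity
  · push Not at hxy
    have h1 := (abs_le.1 (hB x)).2
    have h2 := (abs_le.1 (hB y)).1
    have h3 : 2 * B ≤ 2 * B / δ * r (G.op (G.inv x) y) := by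
      rw [div_mul_eq_mul_div, le_div_iff₀ hδ]; gcongr
    nlinarith

theorem IsLipLoc.mul (hr : G.IsHomogeneousNorm r) {u v : (Fin n → ℝ) → ℝ}
    (hu : G.IsLipLoc r u) (hv : G.IsLipLoc r v) : G.IsLipLoc r (fun x => u x * v x) := by
  intro x
  obtain ⟨U, hU, h⟩ := hu x
  obtain ⟨V, hV, h'⟩ := hv x
  obtain ⟨C, hC, h⟩ := h.exists_abs_le hr
  obtain ⟨D, hD, h'⟩ := h'.exists_abs_le hr
  have h1 : ∀ᶠ y in 𝓝 x, |u y| < |u x| + 1 :=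
    (hu.continuous hr).abs.continuousAt.eventually_lt_const (lt_add_one _)
  have h2 : ∀ᶠ y in 𝓝 x, |v y| < |v x| + 1 :=
    (hv.continuous hr).abs.continuousAt.eventually_lt_const (lt_add_one _)
  refine ⟨U ∩ V ∩ {y | |u y| < |u x| + 1} ∩ {y | |v y| < |v x| + 1},
    inter_mem (inter_mem (inter_mem hU hV) h1) h2, (|u x| + 1) * D + (|v x| + 1) * C,
    by positivity, ?_⟩
  rintro y ⟨⟨⟨hyU, hyV⟩, hy1⟩, hy2⟩ z ⟨⟨⟨hzU, hzV⟩, hz1⟩, hz2⟩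
  have hr0 := hr.nonneg (G.op (G.inv y) z)
  have e : u y * v y - u z * v z = u y * (v y - v z) + v z * (u y - u z) := by ring
  calc u y * v y - u z * v z ≤ |u y * (v y - v z) + v z * (u y - u z)| := by
        rw [e]; exact le_abs_self _
    _ ≤ |u y| * |v y - v z| + |v z| * |u y - u z| := by
        rw [← abs_mul, ← abs_mul]; exact abs_add_le _ _
    _ ≤ (|u x| + 1) * (D * r (G.op (G.inv y) z)) + (|v x| + 1) * (C * r (G.op (G.inv y) z)) := by
        gcongr
        · exact le_of_lt hy1
        · exact h' y hyV z hzV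
        · exact le_of_lt hz2
        · exact h y hyU z hzU
    _ = _ := by ring

theorem IsLipLoc.max_sub (hr : G.IsHomogeneousNorm r) {u : (Fin n → ℝ) → ℝ}
    (hu : G.IsLipLoc r u) (γ : ℝ) : G.IsLipLoc r (fun x => max (u x - γ) 0) := by
  intro x
  obtain ⟨U, hU, C, hC, h⟩ := hu x
  refine ⟨U, hU, C, hC, fun y hy z hz => ?_⟩
  have h1 := h y hy z hz
  have hr0 := mul_nonneg hC.le (hr.nonneg (G.op (G.inv y) z))
  rw [sub_le_iff_le_add]
  refine max_le ?_ ?_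
  · linarith [le_max_left (u z - γ) 0]
  · linarith [le_max_right (u z - γ) 0]

theorem IsLipLoc.neg (hr : G.IsHomogeneousNorm r) {u : (Fin n → ℝ) → ℝ}
    (hu : G.IsLipLoc r u) : G.IsLipLoc r (fun x => - u x) := by
  intro x
  obtain ⟨U, hU, C, hC, h⟩ := hu x
  refine ⟨U, hU, C, hC, fun y hy z hz => ?_⟩
  have h1 := h z hz y hy
  rw [hr.inv_op_comm] at h1
  linarith

/-- Smooth functions are locally Lipschitz: in the coordinate `z = x⁻¹ ∘ y` the function is locally
Lipschitz for the Euclidean norm, which near `0` is controlled by the homogeneous norm. -/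
theorem isLipLoc_of_contDiff (hr : G.IsHomogeneousNorm r) {g : (Fin n → ℝ) → ℝ}
    (hg : ContDiff ℝ ∞ g) : G.IsLipLoc r g := by
  intro x
  have h1 : ContDiffAt ℝ 1 (fun q : (Fin n → ℝ) × (Fin n → ℝ) => g (G.op q.1 q.2)) (x, 0) :=
    ((hg.comp G.contDiff_op).of_le (by simp)).contDiffAt
  obtain ⟨K, t, ht, hK⟩ := h1.exists_lipschitzOnWith
  obtain ⟨m, hm, hrm⟩ := hr.exists_norm_le
  have h2 : Tendsto (fun q : (Fin n → ℝ) × (Fin n → ℝ) => (q.1, G.op (G.inv q.1) q.2))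
      (𝓝 x ×ˢ 𝓝 x) (𝓝 (x, 0)) := by
    have := (continuous_fst.prodMk G.continuous_inv_op).tendsto (x, x)
    rwa [nhds_prod_eq, G.inv_op] at this
  have h3 : Tendsto (fun q : (Fin n → ℝ) × (Fin n → ℝ) => (q.1, (0 : Fin n → ℝ)))
      (𝓝 x ×ˢ 𝓝 x) (𝓝 (x, 0)) := by
    rw [← nhds_prod_eq]
    exact (continuous_fst.prodMk continuous_const).tendsto (x, x)
  have h4 : ∀ᶠ q : (Fin n → ℝ) × (Fin n → ℝ) in 𝓝 x ×ˢ 𝓝 x, r (G.op (G.inv q.1) q.2) < m := by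
    have := (hr.continuous.comp G.continuous_inv_op).tendsto (x, x)
    rw [Function.comp_apply, G.inv_op, hr.apply_zero, nhds_prod_eq] at this
    exact this.eventually_lt_const hm
  obtain ⟨U, hU, hUU⟩ := Filter.mem_prod_same_iff.1
    (inter_mem (inter_mem (h2 ht) (h3 ht)) h4)
  refine ⟨U, hU, (K + 1) / m, by positivity, fun y hy z hz => ?_⟩
  obtain ⟨⟨h5, h6⟩, h7⟩ := hUU (Set.mk_mem_prod hy hz)
  have h8 := hK.dist_le_mul _ h6 _ h5
  simp only [G.op_inv_cancel, G.op_zero, Prod.dist_eq, dist_self, dist_zero_left,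
    norm_nonneg, sup_of_le_right] at h8
  have h9 := hrm _ h7
  calc g y - g z ≤ |g y - g z| := le_abs_self _
    _ ≤ K * ‖G.op (G.inv y) z‖ := h8
    _ ≤ (K + 1) * (r (G.op (G.inv y) z) / m) := by
        gcongr; linarith
    _ = _ := by ring

/-! ### Weak derivatives and difference quotients -/

/-- The difference quotient of `u` at `x` between `x` and `x ∘ s e_j`. -/
noncomputable def diffQuot (G : CarnotGroup n) (j : G.Hor) (s : ℝ) (u : (Fin n → ℝ) → ℝ)
    (x : Fin n → ℝ) : ℝ :=
  (u (G.op x (G.axis j s)) - u x) / s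

theorem continuous_diffQuot (j : G.Hor) (s : ℝ) {u : (Fin n → ℝ) → ℝ} (hu : Continuous u) :
    Continuous (G.diffQuot j s u) :=
  ((hu.comp (G.contDiff_op_left _).continuous).sub hu).div_const _

theorem abs_diffQuot_le (hr : G.IsHomogeneousNorm r) (j : G.Hor) {u : (Fin n → ℝ) → ℝ} {M s : ℝ}
    (hs : 0 < s) {x : Fin n → ℝ}
    (h : |u x - u (G.op x (G.axis j s))| ≤
      M * r (G.op (G.inv x) (G.op x (G.axis j s)))) :
    |G.diffQuot j s u x| ≤ M * r (G.axis j 1) := by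
  rw [G.inv_op_cancel, hr.axis j hs, abs_sub_comm] at h
  rw [diffQuot, abs_div, abs_of_pos hs, div_le_iff₀ hs]
  linarith

theorem IsLipLoc.exists_abs_diffQuot_le (hr : G.IsHomogeneousNorm r) (j : G.Hor)
    {u : (Fin n → ℝ) → ℝ} (hu : G.IsLipLoc r u) {K : Set (Fin n → ℝ)} (hK : IsCompact K) :
    ∃ M : ℝ, 0 ≤ M ∧ ∀ᶠ s in 𝓝[>] (0 : ℝ), ∀ x ∈ K, |G.diffQuot j s u x| ≤ M := by
  obtain ⟨M, hM, δ, hδ, h⟩ := hu.exists_abs_le_of_isCompact hr hK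
  refine ⟨M * r (G.axis j 1), mul_nonneg hM.le (hr.nonneg _), ?_⟩
  have h1 : Tendsto (fun s => r (G.axis j s)) (𝓝[>] 0) (𝓝 0) := by
    have := (hr.continuous.comp (G.continuous_axis j)).tendsto 0
    rw [Function.comp_apply, G.axis_zero, hr.apply_zero] at this
    exact this.mono_left nhdsWithin_le_nhds
  filter_upwards [h1.eventually_lt_const hδ, self_mem_nhdsWithin] with s hs hs0 x hx
  exact abs_diffQuot_le hr j hs0 (h x hx _ (by rwa [G.inv_op_cancel]))

/-- Difference quotients converge to the distributional derivative. Since right translations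
preserve the measure, the quotient can be moved onto the test function. -/
theorem tendsto_integral_diffQuot (hr : G.IsHomogeneousNorm r) (j : G.Hor)
    {u η : (Fin n → ℝ) → ℝ} (hu : Continuous u) (hη : ContDiff ℝ ∞ η) (hc : HasCompactSupport η) :
    Tendsto (fun s => ∫ x, G.diffQuot j s u x * η x) (𝓝[>] 0)
      (𝓝 (- ∫ x, u x * fderiv ℝ η x (G.X j x))) := by
  have hηc := hη.continuous
  have htr : ∀ s, Continuous fun x => G.op x (G.axis j s) :=
    fun s => (G.contDiff_op_left _).continuous
  -- The quotient on `u` is traded for the one on `η`.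
  have key : ∀ s, ∫ x, G.diffQuot j s u x * η x =
      ∫ x, u (G.op x (G.axis j s)) * (-G.diffQuot j s η x) := by
    intro s
    have i1 : Integrable fun x => u x * η x :=
      (hu.mul hηc).integrable_of_hasCompactSupport hc.mul_left
    have i2 : Integrable fun x => u (G.op x (G.axis j s)) * η x :=
      ((hu.comp (htr s)).mul hηc).integrable_of_hasCompactSupport hc.mul_left
    have i3 : Integrable fun x => u (G.op x (G.axis j s)) * η (G.op x (G.axis j s)) :=
      (G.measurePreserving_op_left _).integrable_comp_of_integrable i1
    have e3 : ∫ x, u (G.op x (G.axis j s)) * η (G.op x (G.axis j s)) = ∫ x, u x * η x :=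
      G.integral_op_left _ fun x => u x * η x
    calc ∫ x, G.diffQuot j s u x * η x
        = ∫ x, (u (G.op x (G.axis j s)) * η x - u x * η x) / s := by
          congr 1; ext x; simp only [diffQuot]; ring
      _ = ∫ x, (u (G.op x (G.axis j s)) * η x -
            u (G.op x (G.axis j s)) * η (G.op x (G.axis j s))) / s := by
          rw [integral_div, integral_div, integral_sub i2 i1, integral_sub i2 i3, e3]
      _ = _ := by congr 1; ext x; simp only [diffQuot]; ring
  simp_rw [key]
  rw [← integral_neg]
  -- A compact set that contains the supports of all difference quotients of `η` with `s ≤ 1`.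
  let K : Set (Fin n → ℝ) := (fun q : (Fin n → ℝ) × ℝ => G.op q.1 (G.inv (G.axis j q.2))) ''
    (tsupport η ×ˢ Set.Icc 0 1)
  have hK : IsCompact K := (hc.isCompact.prod isCompact_Icc).image
    (G.continuous_op.comp (continuous_fst.prodMk
      (G.continuous_inv.comp ((G.continuous_axis j).comp continuous_snd))))
  have hzero : ∀ s ∈ Set.Icc (0 : ℝ) 1, ∀ x, x ∉ K → G.diffQuot j s η x = 0 := by
    intro s hs x hx
    have h1 : η x = 0 := image_eq_zero_of_notMem_tsupport fun h => hx
      ⟨(x, 0), ⟨h, by simp⟩, by simp [G.axis_zero, G.inv_zero, G.op_zero]⟩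
    have h2 : η (G.op x (G.axis j s)) = 0 := image_eq_zero_of_notMem_tsupport fun h => hx
      ⟨(_, s), ⟨h, hs⟩, by simp [G.op_op_inv]⟩
    simp [diffQuot, h1, h2]
  obtain ⟨C, hC, hLip⟩ := ((isLipLoc_of_contDiff hr hη).isLipOn_univ hr hc).exists_abs_le hr
  have hbd : ∃ B, ∀ q ∈ K ×ˢ Set.Icc (0 : ℝ) 1, ‖u (G.op q.1 (G.axis j q.2))‖ ≤ B :=
    (hK.prod isCompact_Icc).exists_bound_of_continuousOn (hu.comp (G.continuous_op.comp
      (continuous_fst.prodMk ((G.continuous_axis j).comp continuous_snd)))).continuousOn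
  obtain ⟨B, hB⟩ := hbd
  have hsmall : ∀ᶠ s : ℝ in 𝓝[>] 0, s ∈ Set.Ioc (0 : ℝ) 1 := Ioc_mem_nhdsGT one_pos
  refine tendsto_integral_filter_of_dominated_convergence
    (K.indicator fun _ => B * (C * r (G.axis j 1))) ?_ ?_ ?_ ?_
  · exact Eventually.of_forall fun s =>
      ((hu.comp (htr s)).mul (continuous_diffQuot j s hηc).neg).aestronglyMeasurable
  · filter_upwards [hsmall] with s hs
    refine Eventually.of_forall fun x => ?_
    by_cases hx : x ∈ K
    · rw [Set.indicator_of_mem hx, norm_mul, norm_neg]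
      have h1 := hB (x, s) ⟨hx, hs.1.le, hs.2⟩
      exact mul_le_mul h1
        (abs_diffQuot_le hr j hs.1 (hLip x trivial _ trivial)) (norm_nonneg _)
        ((norm_nonneg _).trans h1)
    · rw [Set.indicator_of_notMem hx, hzero s ⟨hs.1.le, hs.2⟩ x hx]; simp
  · exact (integrable_indicator_iff hK.measurableSet).2
      (integrableOn_const hK.measure_lt_top.ne)
  · refine Eventually.of_forall fun x => ?_
    have h1 := (G.hasDerivAt_comp_op_axis j x
      (hη.differentiable (by simp) x)).tendsto_slope_zero_right
    have h2 : Tendsto (fun s => G.diffQuot j s η x) (𝓝[>] 0) (𝓝 (fderiv ℝ η x (G.X j x))) := by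
      refine h1.congr fun s => ?_
      simp only [zero_add, G.axis_zero, G.op_zero, diffQuot, smul_eq_mul]
      ring
    have h3 : Tendsto (fun s => u (G.op x (G.axis j s))) (𝓝[>] 0) (𝓝 (u x)) := by
      have := (hu.comp ((G.contDiff_op_right x).continuous.comp (G.continuous_axis j))).tendsto 0
      simp only [Function.comp_apply, G.axis_zero, G.op_zero] at this
      exact this.mono_left nhdsWithin_le_nhds
    simpa using h3.mul h2.neg

theorem IsWeakDeriv.tendsto_diffQuot (hr : G.IsHomogeneousNorm r) {j : G.Hor}
    {u g η : (Fin n → ℝ) → ℝ} (hu : Continuous u) (hg : G.IsWeakDeriv j u g)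
    (hη : ContDiff ℝ ∞ η) (hc : HasCompactSupport η) :
    Tendsto (fun s => ∫ x, G.diffQuot j s u x * η x) (𝓝[>] 0) (𝓝 (∫ x, g x * η x)) := by
  have := tendsto_integral_diffQuot hr j hu hη hc
  rwa [hg.2.2 η hη hc, neg_neg] at this

/-- The weak horizontal derivatives of a locally Lipschitz function are locally bounded: their
mollifications are limits of bounded difference quotients. -/
theorem IsWeakDeriv.exists_ae_abs_le (hr : G.IsHomogeneousNorm r) {j : G.Hor}
    {u g : (Fin n → ℝ) → ℝ} (hu : G.IsLipLoc r u) (hg : G.IsWeakDeriv j u g)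
    {K : Set (Fin n → ℝ)} (hK : IsCompact K) :
    ∃ M : ℝ, 0 ≤ M ∧ ∀ᵐ x, x ∈ K → |g x| ≤ M := by
  have huc := hu.continuous hr
  obtain ⟨M, hM, hs⟩ := hu.exists_abs_diffQuot_le hr j (hK.cthickening (r := 1))
  refine ⟨M, hM, ?_⟩
  let B : ℕ → ContDiffBump (0 : Fin n → ℝ) := fun k =>
    ⟨1 / ((k : ℝ) + 1) / 2, 1 / ((k : ℝ) + 1), by positivity, half_lt_self (by positivity)⟩
  have hB : Tendsto (fun k => (B k).rOut) atTop (𝓝 0) := tendsto_one_div_add_atTop_nhds_zero_nat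
  have hconv := ContDiffBump.ae_convolution_tendsto_right_of_locallyIntegrable (μ := volume)
    (K := 2) hB (Eventually.of_forall fun k => by simp only [B]; linarith) hg.2.1
  filter_upwards [hconv] with x hx hxK
  refine le_of_tendsto hx.abs (Eventually.of_forall fun k => ?_)
  rw [convolution_eq_swap]
  simp only [ContinuousLinearMap.lsmul_apply, smul_eq_mul]
  let η : (Fin n → ℝ) → ℝ := fun t => (B k).normed volume (x - t)
  have hη : ContDiff ℝ ∞ η :=
    ((B k).contDiff_normed (n := ⊤)).comp (contDiff_const.sub contDiff_id)
  have hηc : HasCompactSupport η :=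
    (B k).hasCompactSupport_normed.comp_homeomorph (Homeomorph.subLeft x)
  have hη0 : ∀ t, t ∉ Metric.cthickening 1 K → η t = 0 := by
    intro t ht
    by_contra hne
    have h1 : x - t ∈ Function.support ((B k).normed volume) := hne
    rw [(B k).support_normed_eq, mem_ball_zero_iff] at h1
    refine ht (Metric.mem_cthickening_of_dist_le t x 1 K hxK ?_)
    rw [dist_comm, dist_eq_norm]
    refine h1.le.trans ?_
    simp only [B]
    rw [div_le_one (by positivity)]; linarith [Nat.cast_nonneg (α := ℝ) k]
  have hηn : ∀ t, 0 ≤ η t := fun t => (B k).nonneg_normed _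
  have hη1 : ∫ t, η t = 1 := by
    rw [← (B k).integral_normed (μ := volume)]
    exact integral_sub_left_eq_self (fun t => (B k).normed volume t) volume x
  have hlim := (hg.tendsto_diffQuot hr huc hη hηc).abs
  have e : ∫ t, (B k).normed volume (x - t) * g t = ∫ t, g t * η t := by
    congr 1; ext t; exact mul_comm _ _
  rw [e]
  refine le_of_tendsto hlim ?_
  filter_upwards [hs] with s hs
  calc |∫ t, G.diffQuot j s u t * η t| ≤ ∫ t, |G.diffQuot j s u t * η t| :=
        abs_integral_le_integral_abs
    _ ≤ ∫ t, M * η t := by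
        refine integral_mono_of_nonneg (Eventually.of_forall fun _ => abs_nonneg _)
          ((hη.continuous.integrable_of_hasCompactSupport hηc).const_mul M)
          (Eventually.of_forall fun t => ?_)
        by_cases ht : t ∈ Metric.cthickening 1 K
        · simp only [abs_mul, abs_of_nonneg (hηn t)]
          exact mul_le_mul_of_nonneg_right (hs t ht) (hηn t)
        · simp [hη0 t ht]
    _ = M := by rw [integral_const_mul, hη1, mul_one]

/-- For locally Lipschitz `u` the convergence of difference quotients to the weak derivative can be
tested against continuous functions, by uniform approximation. -/
theorem IsWeakDeriv.tendsto_diffQuot_continuous (hr : G.IsHomogeneousNorm r) {j : G.Hor}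
    {u g h : (Fin n → ℝ) → ℝ} (hu : G.IsLipLoc r u) (hg : G.IsWeakDeriv j u g)
    (hh : Continuous h) (hc : HasCompactSupport h) :
    Tendsto (fun s => ∫ x, G.diffQuot j s u x * h x) (𝓝[>] 0) (𝓝 (∫ x, g x * h x)) := by
  have huc := hu.continuous hr
  obtain ⟨M, hM, hs⟩ := hu.exists_abs_diffQuot_le hr j hc.isCompact
  obtain ⟨M', hM', hg'⟩ := hg.exists_ae_abs_le hr hu hc.isCompact
  set V := volume.real (tsupport h) with hV
  have hV0 : 0 ≤ V := measureReal_nonneg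
  -- Replacing `h` by a uniformly close `k` costs at most `N · V · δ`.
  have cost : ∀ (D k : (Fin n → ℝ) → ℝ) (N δ : ℝ), LocallyIntegrable D → Continuous k →
      Function.support k ⊆ Function.support h → (∀ x, dist (k x) (h x) < δ) → 0 ≤ N →
      (∀ᵐ x, x ∈ tsupport h → |D x| ≤ N) →
      |(∫ x, D x * k x) - ∫ x, D x * h x| ≤ N * δ * V := by
    intro D k N δ hD hk hsub hkh hN hDN
    have hkc : HasCompactSupport k := hc.mono hsub
    have i1 : Integrable fun x => D x * k x :=
      hD.integrable_smul_right_of_hasCompactSupport hk hkc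
    have i2 : Integrable fun x => D x * h x :=
      hD.integrable_smul_right_of_hasCompactSupport hh hc
    rw [← integral_sub i1 i2]
    have e : ∫ x in tsupport h, (D x * k x - D x * h x) = ∫ x, (D x * k x - D x * h x) := by
      refine setIntegral_eq_integral_of_forall_compl_eq_zero fun x hx => ?_
      have h1 : h x = 0 := image_eq_zero_of_notMem_tsupport hx
      have h2 : k x = 0 := by
        by_contra hne; exact hsub hne h1
      rw [h1, h2]; simp
    rw [← e, ← Real.norm_eq_abs]
    refine norm_setIntegral_le_of_norm_le_const_ae' (μ := volume)
      hc.isCompact.measure_lt_top ?_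
    filter_upwards [hDN] with x hx hxm
    rw [← mul_sub, norm_mul]
    exact mul_le_mul (hx hxm) (hkh x).le (norm_nonneg _) hN
  rw [Metric.tendsto_nhds]
  intro ε hε
  obtain ⟨δ, hδ, hδε⟩ : ∃ δ > 0, (M + M') * δ * V < ε / 2 := by
    refine ⟨ε / 2 / ((M + M') * V + 1), by positivity, ?_⟩
    rw [mul_right_comm, ← mul_div_assoc, div_lt_iff₀ (by positivity)]
    nlinarith [show 0 ≤ (M + M') * V by positivity]
  obtain ⟨k, hk, hkh, hsub⟩ := hh.exists_contDiff_approx ⊤ (ε := fun _ => δ) (by fun_prop)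
    (fun _ => hδ)
  have hlim := hg.tendsto_diffQuot hr huc hk (hc.mono hsub)
  filter_upwards [hs, (Metric.tendsto_nhds.1 hlim) (ε / 2) (half_pos hε)] with s hs1 hs2
  have c1 := cost _ k M δ (continuous_diffQuot j s huc).locallyIntegrable hk.continuous hsub hkh hM
    (Eventually.of_forall hs1)
  have c2 := cost g k M' δ hg.2.1 hk.continuous hsub hkh hM' hg'
  rw [Real.dist_eq] at hs2 ⊢
  rw [abs_le] at c1 c2
  rw [abs_lt] at hs2 ⊢
  constructor <;> nlinarith [c1.1, c1.2, c2.1, c2.2, hs2.1, hs2.2]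

/-! ### Calculus rules for weak derivatives -/

theorem sq_max_sub_sq_max_le (a b : ℝ) :
    |max b 0 ^ 2 - max a 0 ^ 2 - 2 * max a 0 * (b - a)| ≤ (b - a) ^ 2 := by
  rcases le_total a 0 with ha | ha <;> rcases le_total b 0 with hb | hb <;>
    simp only [max_eq_left, max_eq_right, ha, hb] <;> rw [abs_le] <;> constructor <;> nlinarith

/-- Chain rule for the `C¹` function `t ↦ ((t - γ)₊)²`. -/
theorem IsWeakDeriv.sq_max_sub (hr : G.IsHomogeneousNorm r) {j : G.Hor}
    {u g : (Fin n → ℝ) → ℝ} (hu : G.IsLipLoc r u) (hg : G.IsWeakDeriv j u g) (γ : ℝ) :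
    G.IsWeakDeriv j (fun x => max (u x - γ) 0 ^ 2) (fun x => 2 * max (u x - γ) 0 * g x) := by
  have huc := hu.continuous hr
  have hv : Continuous fun x => max (u x - γ) 0 := by fun_prop
  refine ⟨(hv.pow 2).locallyIntegrable, hg.2.1.continuous_mul (by fun_prop), fun η hη hc => ?_⟩
  have hηc := hη.continuous
  set w : (Fin n → ℝ) → ℝ := fun x => max (u x - γ) 0 ^ 2 with hw
  have h1 := tendsto_integral_diffQuot hr j (u := w) (hv.pow 2) hη hc
  have h2 := hg.tendsto_diffQuot_continuous hr hu (h := fun x => 2 * max (u x - γ) 0 * η x)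
    (by fun_prop) hc.mul_left
  obtain ⟨M, hM, hs⟩ := hu.exists_abs_diffQuot_le hr j hc.isCompact
  have h3 : Tendsto (fun s => (∫ x, G.diffQuot j s w x * η x) -
      ∫ x, G.diffQuot j s u x * (2 * max (u x - γ) 0 * η x)) (𝓝[>] 0) (𝓝 0) := by
    have hb : Tendsto (fun s : ℝ => s * (M ^ 2 * ∫ x, |η x|)) (𝓝[>] 0) (𝓝 0) := by
      have : Continuous fun s : ℝ => s * (M ^ 2 * ∫ x, |η x|) := by fun_prop
      have := this.tendsto 0
      rw [zero_mul] at this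
      exact this.mono_left nhdsWithin_le_nhds
    refine squeeze_zero_norm' ?_ hb
    filter_upwards [hs, self_mem_nhdsWithin] with s hs1 hs0
    have hs0 : 0 < s := hs0
    have hDu := continuous_diffQuot (G := G) j s huc
    have hDw := continuous_diffQuot (G := G) j s (u := w) (hv.pow 2)
    have i1 : Integrable fun x => G.diffQuot j s w x * η x :=
      (hDw.mul hηc).integrable_of_hasCompactSupport hc.mul_left
    have i2 : Integrable fun x => G.diffQuot j s u x * (2 * max (u x - γ) 0 * η x) :=
      (hDu.mul ((hv.const_mul 2).mul hηc)).integrable_of_hasCompactSupport hc.mul_left.mul_left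
    rw [← integral_sub i1 i2, ← mul_assoc, ← integral_const_mul]
    refine norm_integral_le_of_norm_le
      ((hηc.abs.integrable_of_hasCompactSupport hc.norm).const_mul _)
      (Eventually.of_forall fun x => ?_)
    by_cases hx : x ∈ tsupport η
    · have e : G.diffQuot j s w x * η x - G.diffQuot j s u x * (2 * max (u x - γ) 0 * η x) =
          (G.diffQuot j s w x - 2 * max (u x - γ) 0 * G.diffQuot j s u x) * η x := by ring
      rw [e, norm_mul]
      refine mul_le_mul_of_nonneg_right ?_ (norm_nonneg _)
      have key := sq_max_sub_sq_max_le (u x - γ) (u (G.op x (G.axis j s)) - γ)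
      have e1 : G.diffQuot j s w x - 2 * max (u x - γ) 0 * G.diffQuot j s u x =
          (max (u (G.op x (G.axis j s)) - γ) 0 ^ 2 - max (u x - γ) 0 ^ 2 -
            2 * max (u x - γ) 0 * (u (G.op x (G.axis j s)) - γ - (u x - γ))) / s := by
        simp only [diffQuot, hw]; ring
      have e2 : (u (G.op x (G.axis j s)) - γ - (u x - γ)) ^ 2 =
          s ^ 2 * G.diffQuot j s u x ^ 2 := by
        simp only [diffQuot]; field_simp; ring
      rw [e1, norm_div, Real.norm_eq_abs, Real.norm_eq_abs, abs_of_pos hs0, div_le_iff₀ hs0]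
      refine key.trans ?_
      rw [e2]
      have : G.diffQuot j s u x ^ 2 ≤ M ^ 2 :=
        sq_le_sq' (abs_le.1 (hs1 x hx)).1 (abs_le.1 (hs1 x hx)).2
      nlinarith [sq_nonneg s]
    · simp [image_eq_zero_of_notMem_tsupport hx]
  have h4 := tendsto_nhds_unique h3 (h1.sub h2)
  have e : ∫ x, 2 * max (u x - γ) 0 * g x * η x = ∫ x, g x * (2 * max (u x - γ) 0 * η x) := by
    congr 1; ext x; ring
  rw [e]
  linarith

/-- Leibniz rule for a smooth factor. -/
theorem IsWeakDeriv.smooth_mul {j : G.Hor} {w g ζ : (Fin n → ℝ) → ℝ}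
    (hg : G.IsWeakDeriv j w g) (hζ : ContDiff ℝ ∞ ζ) :
    G.IsWeakDeriv j (fun x => ζ x * w x)
      (fun x => ζ x * g x + fderiv ℝ ζ x (G.X j x) * w x) := by
  have hX : Continuous fun x => fderiv ℝ ζ x (G.X j x) :=
    (hζ.continuous_fderiv (by simp)).clm_apply (G.contDiff_X j).continuous
  refine ⟨hg.1.continuous_mul hζ.continuous, (hg.2.1.continuous_mul hζ.continuous).add
    (hg.1.continuous_mul hX), fun η hη hc => ?_⟩
  have hXη : Continuous fun x => fderiv ℝ η x (G.X j x) :=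
    (hη.continuous_fderiv (by simp)).clm_apply (G.contDiff_X j).continuous
  have h1 := hg.2.2 (fun x => ζ x * η x) (hζ.mul hη) hc.mul_left
  have hXc : HasCompactSupport fun x => fderiv ℝ η x (G.X j x) := by
    refine (hc.fderiv ℝ).mono fun x hx => ?_
    intro h0; apply hx; simp [h0]
  have hf : ∀ x, fderiv ℝ (fun x => ζ x * η x) x (G.X j x) =
      ζ x * fderiv ℝ η x (G.X j x) + η x * fderiv ℝ ζ x (G.X j x) := by
    intro x
    rw [fderiv_fun_mul (hζ.differentiable (by simp) x) (hη.differentiable (by simp) x)]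
    simp
  have i1 : Integrable fun x => w x * (ζ x * fderiv ℝ η x (G.X j x)) :=
    hg.1.integrable_smul_right_of_hasCompactSupport (hζ.continuous.mul hXη) hXc.mul_left
  have i2 : Integrable fun x => w x * (η x * fderiv ℝ ζ x (G.X j x)) :=
    hg.1.integrable_smul_right_of_hasCompactSupport (hη.continuous.mul hX) hc.mul_right
  have i3 : Integrable fun x => g x * (ζ x * η x) :=
    hg.2.1.integrable_smul_right_of_hasCompactSupport (hζ.continuous.mul hη.continuous)
      hc.mul_left
  simp only [hf, mul_add] at h1
  rw [integral_add i1 i2] at h1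
  have e1 : ∫ x, ζ x * w x * fderiv ℝ η x (G.X j x) =
      ∫ x, w x * (ζ x * fderiv ℝ η x (G.X j x)) := by congr 1; ext x; ring
  have e2 : ∫ x, (ζ x * g x + fderiv ℝ ζ x (G.X j x) * w x) * η x =
      (∫ x, g x * (ζ x * η x)) + ∫ x, w x * (η x * fderiv ℝ ζ x (G.X j x)) := by
    rw [← integral_add i3 i2]; congr 1; ext x; ring
  rw [e1, e2]; linarith

/-! ### Functions with vanishing horizontal gradient -/

/-- A smooth function annihilated by the generating fields is annihilated by all their iterated
brackets, hence is constant. -/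
theorem fderiv_eq_zero_of_X (G : CarnotGroup n) {F : (Fin n → ℝ) → ℝ} (hF : ContDiff ℝ ∞ F)
    (h : ∀ j x, fderiv ℝ F x (G.X j x) = 0) (x : Fin n → ℝ) : fderiv ℝ F x = 0 := by
  have key : ∀ Z, IsIteratedBracket G.X Z → ContDiff ℝ ∞ Z ∧ ∀ x, fderiv ℝ F x (Z x) = 0 := by
    intro Z hZ
    induction hZ with
    | base j => exact ⟨G.contDiff_X j, h j⟩
    | bracket Y Z _ _ hY hZ =>
      refine ⟨hY.1.lieBracket_vectorField hZ.1 (by simp), fun x => ?_⟩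
      rw [VectorField.fderiv_apply_lieBracket (n := ∞) hF.contDiffAt
        (by
          rw [minSmoothness_of_isRCLikeNormedField]
          exact WithTop.coe_le_coe.2 (le_top : (2 : ℕ∞) ≤ ⊤))
        (hZ.1.differentiable (by simp) x) (hY.1.differentiable (by simp) x)]
      simp [hY.2, hZ.2]
  have h1 : ⊤ ≤ LinearMap.ker (fderiv ℝ F x : (Fin n → ℝ) →ₗ[ℝ] ℝ) := by
    rw [← G.generating x, Submodule.span_le]
    rintro v ⟨Z, hZ, rfl⟩
    exact (key Z hZ).2 x
  ext1 v
  exact h1 (Submodule.mem_top : v ∈ ⊤)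

/-- The average `x ↦ ∫ v (y ∘ x) ρ (y) dy` of left translates of `v` is smooth, since the
substitution `z = y ∘ x` moves the variable `x` into `ρ`. -/
theorem contDiff_integral_op (G : CarnotGroup n) {v ρ : (Fin n → ℝ) → ℝ} (hv : Continuous v)
    (hρ : ContDiff ℝ ∞ ρ) (hc : HasCompactSupport ρ) :
    ContDiff ℝ ∞ fun x => ∫ y, v (G.op y x) * ρ y := by
  have e : ∀ x, ∫ y, v (G.op y x) * ρ y = ∫ z, v z * ρ (G.op z (G.inv x)) := by
    intro x
    rw [← G.integral_op_left (G.inv x) fun y => v (G.op y x) * ρ y]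
    simp only [G.op_inv_op]
  simp_rw [e]
  refine contDiff_iff_contDiffAt.2 fun x₀ => ?_
  have hK : IsCompact ((fun q : (Fin n → ℝ) × (Fin n → ℝ) => -G.op q.1 q.2) ''
      (tsupport ρ ×ˢ Metric.closedBall x₀ 1)) :=
    (hc.isCompact.prod (isCompact_closedBall x₀ 1)).image G.continuous_op.neg
  have h1 := contDiffOn_convolution_right_with_param_comp (n := ⊤) (μ := volume)
    (ContinuousLinearMap.lsmul ℝ ℝ) (s := Metric.ball x₀ 1)
    (v := fun _ : Fin n → ℝ => (0 : Fin n → ℝ))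
    contDiffOn_const (f := v) (g := fun p t => ρ (G.op (-t) (G.inv p))) Metric.isOpen_ball hK
    (by
      intro p t hp ht
      by_contra hne
      refine ht ⟨(_, p), ⟨subset_tsupport _ hne, Metric.ball_subset_closedBall hp⟩, ?_⟩
      simp [G.op_inv_op])
    hv.locallyIntegrable
    (by
      refine ContDiff.contDiffOn (hρ.comp (G.contDiff_op.comp
        (contDiff_snd.neg.prodMk (G.contDiff_inv.comp contDiff_fst)))))
  have h2 := h1.contDiffAt (Metric.ball_mem_nhds x₀ one_pos)
  refine h2.congr_of_eventuallyEq (Eventually.of_forall fun x => ?_)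
  simp [convolution_def]

/-- A continuous function with vanishing weak horizontal gradient is constant. -/
theorem eq_of_isWeakDeriv_zero (hr : G.IsHomogeneousNorm r) {v : (Fin n → ℝ) → ℝ}
    (hv : Continuous v) (h : ∀ j, G.IsWeakDeriv j v fun _ => 0) (x : Fin n → ℝ) : v x = v 0 := by
  have hconst : ∀ ρ : (Fin n → ℝ) → ℝ, ContDiff ℝ ∞ ρ → HasCompactSupport ρ →
      ∫ y, v (G.op y x) * ρ y = ∫ y, v (G.op y 0) * ρ y := by
    intro ρ hρ hc
    have hF := contDiff_integral_op G hv hρ hc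
    refine is_const_of_fderiv_eq_zero (𝕜 := ℝ) (hF.differentiable (by simp))
      (fderiv_eq_zero_of_X G hF fun j x => ?_) x 0
    have h1 := (G.hasDerivAt_comp_op_axis j x
      (hF.differentiable (by simp) x)).tendsto_slope_zero_right
    have hη : ContDiff ℝ ∞ fun z => ρ (G.op z (G.inv x)) := hρ.comp (G.contDiff_op_left _)
    have hηc : HasCompactSupport fun z => ρ (G.op z (G.inv x)) := by
      refine HasCompactSupport.intro (K := (fun y => G.op y x) '' tsupport ρ)
        (hc.isCompact.image (G.contDiff_op_left x).continuous) fun z hz => ?_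
      by_contra hne
      exact hz ⟨_, subset_tsupport _ hne, G.op_inv_op z x⟩
    have h2 := (h j).tendsto_diffQuot hr hv hη hηc
    simp only [zero_mul, integral_zero] at h2
    refine tendsto_nhds_unique h1 (h2.congr fun s => ?_)
    have hi : ∀ a, Integrable fun y => v (G.op y a) * ρ y := fun a =>
      ((hv.comp (G.contDiff_op_left a).continuous).mul
        hρ.continuous).integrable_of_hasCompactSupport hc.mul_left
    simp only [zero_add, G.axis_zero, G.op_zero]
    rw [← integral_sub (hi _) (hi _), ← integral_smul,
      ← G.integral_op_left x fun z => G.diffQuot j s v z * ρ (G.op z (G.inv x))]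
    congr 1; ext y
    simp only [G.op_op_inv, diffQuot, G.op_assoc, smul_eq_mul]
    ring
  have hcont : Continuous fun y => v (G.op y x) - v y :=
    (hv.comp (G.contDiff_op_left x).continuous).sub hv
  have hae := ae_eq_zero_of_integral_contDiff_smul_eq_zero (μ := volume)
    hcont.locallyIntegrable fun ρ hρ hc => by
      have hi : ∀ a, Integrable fun y => v (G.op y a) * ρ y := fun a =>
        ((hv.comp (G.contDiff_op_left a).continuous).mul
          hρ.continuous).integrable_of_hasCompactSupport hc.mul_left
      have h1 := sub_eq_zero.2 (hconst ρ hρ hc)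
      rw [← integral_sub (hi _) (hi _)] at h1
      rw [← h1]
      congr 1; ext y
      simp only [G.op_zero, smul_eq_mul]; ring
  have := congrFun ((hcont.ae_eq_iff_eq volume continuous_const).1 hae) 0
  simp only [G.zero_op] at this
  linarith

end CarnotGroup

/-! ### Locally essentially bounded functions -/

/-- Measurable functions on `ℝⁿ` that are essentially bounded on every compact set. -/
def IsLocEssBdd {n : ℕ} (F : (Fin n → ℝ) → ℝ) : Prop :=
  AEStronglyMeasurable F ∧ ∀ K, IsCompact K → ∃ M : ℝ, ∀ᵐ x, x ∈ K → |F x| ≤ M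

namespace IsLocEssBdd

variable {n : ℕ} {F H : (Fin n → ℝ) → ℝ}

theorem of_continuous (hF : Continuous F) : IsLocEssBdd F :=
  ⟨hF.aestronglyMeasurable, fun _ hK =>
    let ⟨M, hM⟩ := hK.exists_bound_of_continuousOn hF.continuousOn
    ⟨M, Eventually.of_forall hM⟩⟩

theorem mul (hF : IsLocEssBdd F) (hH : IsLocEssBdd H) : IsLocEssBdd fun x => F x * H x := by
  refine ⟨hF.1.mul hH.1, fun K hK => ?_⟩
  obtain ⟨M, hM⟩ := hF.2 K hK
  obtain ⟨M', hM'⟩ := hH.2 K hK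
  refine ⟨M * M', ?_⟩
  filter_upwards [hM, hM'] with x h1 h2 hx
  rw [abs_mul]
  exact mul_le_mul (h1 hx) (h2 hx) (abs_nonneg _) ((abs_nonneg _).trans (h1 hx))

theorem add (hF : IsLocEssBdd F) (hH : IsLocEssBdd H) : IsLocEssBdd fun x => F x + H x := by
  refine ⟨hF.1.add hH.1, fun K hK => ?_⟩
  obtain ⟨M, hM⟩ := hF.2 K hK
  obtain ⟨M', hM'⟩ := hH.2 K hK
  refine ⟨M + M', ?_⟩
  filter_upwards [hM, hM'] with x h1 h2 hx
  exact (abs_add_le _ _).trans (add_le_add (h1 hx) (h2 hx))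

theorem sum {ι : Type*} (t : Finset ι) {A : ι → (Fin n → ℝ) → ℝ} (h : ∀ i, IsLocEssBdd (A i)) :
    IsLocEssBdd fun x => ∑ i ∈ t, A i x := by
  classical
  induction t using Finset.induction_on with
  | empty => simpa using of_continuous (continuous_const (y := (0 : ℝ)))
  | insert i t hi ih => simpa only [Finset.sum_insert hi] using (h i).add ih

theorem comp {φ : ℝ → ℝ} (hφ : ContinuousOn φ (Set.Ici 0)) (hF : IsLocEssBdd F)
    (hF0 : ∀ x, 0 ≤ F x) : IsLocEssBdd fun x => φ (F x) := by
  refine ⟨?_, fun K hK => ?_⟩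
  · have h1 : Continuous fun t : ℝ => φ (max t 0) :=
      hφ.comp_continuous (by fun_prop) fun t => le_max_right t 0
    refine (h1.comp_aestronglyMeasurable hF.1).congr (Eventually.of_forall fun x => ?_)
    simp [hF0 x]
  · obtain ⟨M, hM⟩ := hF.2 K hK
    obtain ⟨B, hB⟩ := isCompact_Icc.exists_bound_of_continuousOn
      (hφ.mono (Set.Icc_subset_Ici_self : Set.Icc 0 M ⊆ Set.Ici 0))
    refine ⟨B, ?_⟩
    filter_upwards [hM] with x hx hxK
    exact hB _ ⟨hF0 x, (le_abs_self _).trans (hx hxK)⟩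

theorem integrableOn (hF : IsLocEssBdd F) {K : Set (Fin n → ℝ)} (hK : IsCompact K) :
    IntegrableOn F K := by
  obtain ⟨M, hM⟩ := hF.2 K hK
  exact Measure.integrableOn_of_bounded hK.measure_lt_top.ne hF.1
    ((ae_restrict_iff' hK.measurableSet).2 hM)

theorem integrable (hF : IsLocEssBdd F) {K : Set (Fin n → ℝ)} (hK : IsCompact K)
    (h : ∀ x, x ∉ K → F x = 0) : Integrable F :=
  (integrableOn_iff_integrable_of_support_subset fun x hx => by
    by_contra hxK; exact hx (h x hxK)).1 (hF.integrableOn hK)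

end IsLocEssBdd

/-! ### Elementary inequalities -/

/-- The cutoff error is absorbed by the two nonnegative terms of the tested inequality: by the
diffusion term where `X` is large compared with `v / R`, and by the gradient term, whose exponent
`-s` in `X` is negative, where `X` is small. The growth exponent `(1 + s - μ) / s` is exactly the
one for which the two regimes match. -/
theorem exists_absorb {s μ κ a θ : ℝ} (hs : 0 < s) (hκ : 0 < κ) (ha : 0 < a) (hθ : 0 < θ) :
    ∃ δ : ℝ, 0 < δ ∧ ∀ R v X Φ β : ℝ, 1 ≤ R → 0 ≤ v → v ≤ δ * R ^ ((1 + s - μ) / s) →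
      0 < X → 0 ≤ Φ → κ * R ^ (-μ) * (Φ / X ^ s) ≤ β →
      a * v ^ 2 * Φ / R ≤ θ * (2 * v * Φ * X + β * v ^ 2) := by
  refine ⟨2 * θ / a * (θ * κ / a) ^ s⁻¹, by positivity, fun R v X Φ β hR hv hvδ hX hΦ hβ => ?_⟩
  have hR0 : 0 < R := by linarith
  have hβ0 : 0 ≤ β := le_trans (by positivity) hβ
  by_cases hc : a * v ≤ 2 * θ * R * X
  · rw [div_le_iff₀ hR0]
    have h1 : v * Φ * (a * v) ≤ v * Φ * (2 * θ * R * X) := by gcongr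
    have h2 : 0 ≤ θ * (β * v ^ 2) * R := by positivity
    nlinarith
  · push Not at hc
    have e : R ^ ((1 + s - μ) / s) = R * (R ^ (1 - μ)) ^ s⁻¹ := by
      have e1 : (1 + s - μ) / s = 1 + (1 - μ) * s⁻¹ := by field_simp; ring
      rw [e1, Real.rpow_add hR0, Real.rpow_one, Real.rpow_mul hR0.le]
    have h1 : X ≤ (θ * κ / a * R ^ (1 - μ)) ^ s⁻¹ := by
      rw [Real.mul_rpow (by positivity) (by positivity)]
      have h2 : a * v ≤ 2 * θ * R * ((θ * κ / a) ^ s⁻¹ * (R ^ (1 - μ)) ^ s⁻¹) := by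
        calc a * v ≤ a * (2 * θ / a * (θ * κ / a) ^ s⁻¹ * R ^ ((1 + s - μ) / s)) := by gcongr
          _ = _ := by rw [e]; field_simp
      exact le_of_mul_le_mul_left (hc.le.trans h2) (by positivity)
    have h2 : X ^ s ≤ θ * κ / a * R ^ (1 - μ) := by
      have := Real.rpow_le_rpow hX.le h1 hs.le
      rwa [Real.rpow_inv_rpow (by positivity) hs.ne'] at this
    have hXs : 0 < X ^ s := Real.rpow_pos_of_pos hX s
    have e2 : R ^ (1 - μ) = R * R ^ (-μ) := by
      rw [sub_eq_add_neg, Real.rpow_add hR0, Real.rpow_one]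
    have h3 : a * Φ / R ≤ θ * β := by
      refine le_trans ?_ (mul_le_mul_of_nonneg_left hβ hθ.le)
      rw [div_le_iff₀ hR0, ← sub_nonneg]
      have e3 : θ * (κ * R ^ (-μ) * (Φ / X ^ s)) * R - a * Φ =
          a * Φ / X ^ s * (θ * κ / a * R ^ (1 - μ) - X ^ s) := by
        rw [e2]; field_simp
      rw [e3]
      exact mul_nonneg (by positivity) (sub_nonneg.2 h2)
    have h4 : a * v ^ 2 * Φ / R = v ^ 2 * (a * Φ / R) := by ring
    rw [h4]
    have h5 : 0 ≤ θ * (2 * v * Φ * X) := by positivity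
    nlinarith [mul_le_mul_of_nonneg_left h3 (sq_nonneg v)]

/-- Caccioppoli-type splitting: with a cutoff raised to a power `q ≥ p`, the growth bound on `φ`
turns the cutoff error into half of the diffusion term and a quantity free of `X`. -/
theorem le_add_of_rpow_le {p C₀ a η R v X Φ : ℝ} {q : ℕ} (hp : 1 < p) (hq : p ≤ q + 1)
    (hC₀ : 0 < C₀) (ha : 0 < a) (hη : 0 ≤ η) (hη1 : η ≤ 1) (hR : 1 ≤ R) (hv : 0 ≤ v)
    (hX : 0 ≤ X) (hΦ : 0 ≤ Φ) (hΦX : Φ ≤ C₀ * X ^ (p - 1)) :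
    a * η ^ q * v ^ 2 * Φ / R ≤
      η ^ (q + 1) * (v * Φ * X) + a * C₀ * v ^ 2 * (a * v) ^ (p - 1) := by
  have hR0 : 0 < R := by linarith
  have hp1 : 0 < p - 1 := by linarith
  by_cases hc : a * v ≤ η * R * X
  · have h1 : a * η ^ q * v ^ 2 * Φ / R ≤ η ^ (q + 1) * (v * Φ * X) := by
      rw [div_le_iff₀ hR0]
      have h2 : η ^ q * v * Φ * (a * v) ≤ η ^ q * v * Φ * (η * R * X) := by gcongr
      calc _ = η ^ q * v * Φ * (a * v) := by ring
        _ ≤ _ := h2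
        _ = _ := by ring
    have h2 : 0 ≤ a * C₀ * v ^ 2 * (a * v) ^ (p - 1) := by positivity
    linarith
  · push Not at hc
    have h0 : 0 ≤ η ^ (q + 1) * (v * Φ * X) := by positivity
    have hq0 : (q : ℝ) ≠ 0 := by intro h; rw [h] at hq; linarith
    have h1 : η ^ q ≤ η ^ (p - 1) := by
      rcases hη.eq_or_lt with h | h
      · rw [← h, zero_pow (by exact_mod_cast hq0), Real.zero_rpow hp1.ne']
      · rw [← Real.rpow_natCast]
        exact Real.rpow_le_rpow_of_exponent_ge h hη1 (by linarith)
    have h2 : η * X ≤ a * v := by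
      have : η * X * 1 ≤ η * X * R := by gcongr
      nlinarith
    calc a * η ^ q * v ^ 2 * Φ / R ≤ a * η ^ q * v ^ 2 * Φ :=
          div_le_self (by positivity) hR
      _ ≤ a * η ^ (p - 1) * v ^ 2 * (C₀ * X ^ (p - 1)) := by gcongr
      _ = a * C₀ * v ^ 2 * (η * X) ^ (p - 1) := by rw [Real.mul_rpow hη hX]; ring
      _ ≤ a * C₀ * v ^ 2 * (a * v) ^ (p - 1) := by gcongr
      _ ≤ _ := by linarith

/-- A nonnegative function of polynomial growth that contracts by a sufficiently small factor when
its argument is divided by `c` vanishes. -/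
theorem eq_zero_of_le_mul_of_le_rpow {J : ℝ → ℝ} {c K N R₀ : ℝ} (hc : 1 < c) (hR₀ : 1 ≤ R₀)
    (hJ : ∀ R, 0 ≤ J R) (hpoly : ∀ R, R₀ ≤ R → J R ≤ K * R ^ N)
    (hit : ∀ R, R₀ ≤ R → J R ≤ (2 * c ^ N)⁻¹ * J (c * R)) {R : ℝ} (hR : R₀ ≤ R) : J R = 0 := by
  have hc0 : 0 < c := by linarith
  have hR0 : 0 < R := by linarith
  have hcN : 0 < c ^ N := Real.rpow_pos_of_pos hc0 N
  have hge : ∀ k : ℕ, R₀ ≤ c ^ k * R := fun k =>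
    hR.trans (le_mul_of_one_le_left hR0.le (one_le_pow₀ hc.le))
  have h1 : ∀ k : ℕ, J R ≤ (2 * c ^ N)⁻¹ ^ k * J (c ^ k * R) := by
    intro k
    induction k with
    | zero => simp
    | succ k ih =>
      refine ih.trans ?_
      rw [pow_succ, mul_assoc]
      refine mul_le_mul_of_nonneg_left ?_ (by positivity)
      have := hit _ (hge k)
      rwa [← mul_assoc, ← pow_succ'] at this
  have h2 : ∀ k : ℕ, J R ≤ (1 / 2 : ℝ) ^ k * (K * R ^ N) := by
    intro k
    refine (h1 k).trans ?_
    calc (2 * c ^ N)⁻¹ ^ k * J (c ^ k * R) ≤ (2 * c ^ N)⁻¹ ^ k * (K * (c ^ k * R) ^ N) := by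
          gcongr; exact hpoly _ (hge k)
      _ = _ := by
          rw [Real.mul_rpow (by positivity) hR0.le, ← Real.rpow_natCast c k, ← Real.rpow_mul hc0.le,
            mul_comm (k : ℝ) N, Real.rpow_mul hc0.le, Real.rpow_natCast, inv_pow, mul_pow,
            one_div, inv_pow]
          field_simp
  have h3 : Tendsto (fun k : ℕ => (1 / 2 : ℝ) ^ k * (K * R ^ N)) atTop (𝓝 0) := by
    simpa using (tendsto_pow_atTop_nhds_zero_of_lt_one (r := (1 / 2 : ℝ)) (by norm_num)
      (by norm_num)).mul_const (K * R ^ N)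
  exact le_antisymm (ge_of_tendsto' h3 h2) (hJ R)

namespace CarnotGroup

variable {n : ℕ} {G : CarnotGroup n} {r : (Fin n → ℝ) → ℝ}

/-! ### Cutoff functions -/

/-- Smooth cutoffs between the balls of radius `R` and `c R`, obtained from a single one by
dilation. As the fields `X_j` are homogeneous of degree one, the horizontal gradient is `O(1/R)`. -/
theorem exists_cutoff (hr : G.IsHomogeneousNorm r) :
    ∃ c A : ℝ, 1 < c ∧ 0 < A ∧ ∀ R : ℝ, 0 < R → ∃ η : (Fin n → ℝ) → ℝ, ContDiff ℝ ∞ η ∧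
      (∀ x, 0 ≤ η x) ∧ (∀ x, η x ≤ 1) ∧ (∀ x, r x ≤ R → η x = 1) ∧
      (∀ x, c * R < r x → η x = 0) ∧
      (∀ x, ∑ j, |fderiv ℝ η x (G.X j x)| ≤ A / R) ∧
      (∀ x, ∑ j, |fderiv ℝ η x (G.X j x)| ≠ 0 → R ≤ r x ∧ r x ≤ c * R) := by
  obtain ⟨ρ, hρ⟩ := (hr.isCompact_le 1).isBounded.subset_closedBall (0 : Fin n → ℝ)
  let g : ContDiffBump (0 : Fin n → ℝ) :=
    ⟨max ρ 1, max ρ 1 + 1, by positivity, lt_add_one _⟩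
  have hg : ContDiff ℝ ∞ g := g.contDiff
  have hgc : HasCompactSupport g := g.hasCompactSupport
  have hg1 : ∀ x, r x ≤ 1 → g x = 1 := fun x hx =>
    g.one_of_mem_closedBall (Metric.closedBall_subset_closedBall (le_max_left _ _) (hρ hx))
  obtain ⟨c, hc⟩ := hgc.isCompact.exists_bound_of_continuousOn hr.continuous.continuousOn
  have hXg : Continuous fun x => ∑ j, |fderiv ℝ g x (G.X j x)| :=
    continuous_finsetSum _ fun j _ =>
      ((hg.continuous_fderiv (by simp)).clm_apply (G.contDiff_X j).continuous).abs
  have hXgc : HasCompactSupport fun x => ∑ j, |fderiv ℝ g x (G.X j x)| := by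
    refine (hgc.fderiv ℝ).mono fun x hx => ?_
    intro h0; apply hx; simp [h0]
  obtain ⟨A, hA⟩ := hXg.bounded_above_of_compact_support hXgc
  have hA' : ∀ x, ∑ j, |fderiv ℝ g x (G.X j x)| ≤ |A| + 1 := fun x =>
    ((le_abs_self _).trans (hA x)).trans (by linarith [le_abs_self A])
  refine ⟨max c 1 + 1, |A| + 1, by linarith [le_max_right c 1], by positivity, fun R hR => ?_⟩
  have hRi : 0 < R⁻¹ := inv_pos.2 hR
  have hη : ContDiff ℝ ∞ fun x => g (G.dilL R⁻¹ x) := hg.comp (G.dilL R⁻¹).contDiff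
  have hone : ∀ x, r x ≤ R → g (G.dilL R⁻¹ x) = 1 := fun x hx => hg1 _ (by
    rw [G.dilL_apply, hr.dil _ hRi, inv_mul_le_iff₀ hR]; linarith)
  have hzero : ∀ x, (max c 1 + 1) * R < r x → g (G.dilL R⁻¹ x) = 0 := fun x hx => by
    by_contra hne
    have h1 := (le_abs_self _).trans (hc _ (subset_tsupport _ hne))
    rw [G.dilL_apply, hr.dil _ hRi, inv_mul_le_iff₀ hR] at h1
    nlinarith [le_max_left c 1]
  refine ⟨fun x => g (G.dilL R⁻¹ x), hη, fun x => g.nonneg, fun x => g.le_one, hone, hzero, ?_, ?_⟩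
  · intro x
    have e : ∀ j, fderiv ℝ (fun x => g (G.dilL R⁻¹ x)) x (G.X j x) =
        R⁻¹ * fderiv ℝ g (G.dil R⁻¹ x) (G.X j (G.dil R⁻¹ x)) := by
      intro j
      have h1 : HasFDerivAt (fun x => g (G.dilL R⁻¹ x))
          ((fderiv ℝ g (G.dilL R⁻¹ x)).comp (G.dilL R⁻¹)) x :=
        (hg.differentiable (by simp) _).hasFDerivAt.comp x (G.dilL R⁻¹).hasFDerivAt
      rw [h1.fderiv, ContinuousLinearMap.comp_apply, G.dilL_apply, G.dilL_apply, G.X_dil j hRi,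
        map_smul, smul_eq_mul]
    simp only [e, abs_mul, ← Finset.mul_sum, abs_of_pos hRi]
    rw [div_eq_inv_mul]
    exact mul_le_mul_of_nonneg_left (hA' _) hRi.le
  · intro x hx
    constructor
    · by_contra! hlt
      refine hx (Finset.sum_eq_zero fun j _ => ?_)
      have h1 : (fun x => g (G.dilL R⁻¹ x)) =ᶠ[𝓝 x] fun _ => 1 := by
        filter_upwards [hr.continuous.continuousAt.eventually_lt_const hlt] with y hy
          using hone y (le_of_lt hy)
      rw [h1.fderiv_eq]; simp
    · by_contra! hlt
      refine hx (Finset.sum_eq_zero fun j _ => ?_)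
      have h1 : (fun x => g (G.dilL R⁻¹ x)) =ᶠ[𝓝 x] fun _ => 0 := by
        filter_upwards [hr.continuous.continuousAt.eventually_const_lt hlt] with y hy
          using hzero y hy
      rw [h1.fderiv_eq]; simp

/-! ### The tested inequality -/

theorem horNorm_nonneg (G : CarnotGroup n) (Y : G.Hor → (Fin n → ℝ) → ℝ) (x : Fin n → ℝ) :
    0 ≤ G.horNorm Y x := Real.sqrt_nonneg _

theorem sum_sq_eq_horNorm_sq (G : CarnotGroup n) (Y : G.Hor → (Fin n → ℝ) → ℝ) (x : Fin n → ℝ) :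
    ∑ j, Y j x ^ 2 = G.horNorm Y x ^ 2 :=
  (Real.sq_sqrt (Finset.sum_nonneg fun _ _ => sq_nonneg _)).symm

theorem abs_le_horNorm (G : CarnotGroup n) (Y : G.Hor → (Fin n → ℝ) → ℝ) (j : G.Hor)
    (x : Fin n → ℝ) : |Y j x| ≤ G.horNorm Y x :=
  Real.abs_le_sqrt (Finset.single_le_sum (f := fun j => Y j x ^ 2) (fun _ _ => sq_nonneg _)
    (Finset.mem_univ j))

theorem IsWeakGrad.isLocEssBdd (hr : G.IsHomogeneousNorm r) {u : (Fin n → ℝ) → ℝ}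
    {U : G.Hor → (Fin n → ℝ) → ℝ} (hu : G.IsLipLoc r u) (hU : G.IsWeakGrad u U) (j : G.Hor) :
    IsLocEssBdd (U j) :=
  ⟨(hU j).2.1.aestronglyMeasurable, fun _ hK =>
    let ⟨M, _, h⟩ := (hU j).exists_ae_abs_le hr hu hK
    ⟨M, h⟩⟩

theorem IsWeakGrad.isLocEssBdd_horNorm (hr : G.IsHomogeneousNorm r) {u : (Fin n → ℝ) → ℝ}
    {U : G.Hor → (Fin n → ℝ) → ℝ} (hu : G.IsLipLoc r u) (hU : G.IsWeakGrad u U) :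
    IsLocEssBdd (G.horNorm U) := by
  have h : IsLocEssBdd fun x => ∑ j, U j x * U j x :=
    IsLocEssBdd.sum _ fun j => (hU.isLocEssBdd hr hu j).mul (hU.isLocEssBdd hr hu j)
  have h2 := h.comp (φ := Real.sqrt) Real.continuous_sqrt.continuousOn
    fun x => Finset.sum_nonneg fun _ _ => mul_self_nonneg _
  unfold horNorm
  simpa only [sq] using h2

/-- The integrand `2 v φ(|∇₀u|) |∇₀u| + b f(u) l(|∇₀u|) v²`, `v = (u - γ)₊`, which appears on the
left when the differential inequality is tested with multiples of `v²`. -/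
noncomputable def energy (G : CarnotGroup n) (φ : ℝ → ℝ) (b : (Fin n → ℝ) → ℝ) (f l : ℝ → ℝ)
    (u : (Fin n → ℝ) → ℝ) (U : G.Hor → (Fin n → ℝ) → ℝ) (γ : ℝ) (x : Fin n → ℝ) : ℝ :=
  2 * max (u x - γ) 0 * φ (G.horNorm U x) * G.horNorm U x +
    b x * f (u x) * l (G.horNorm U x) * max (u x - γ) 0 ^ 2

section

variable {φ : ℝ → ℝ} {b : (Fin n → ℝ) → ℝ} {f l : ℝ → ℝ} {u : (Fin n → ℝ) → ℝ}
  {U : G.Hor → (Fin n → ℝ) → ℝ}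

theorem isLocEssBdd_energy (hr : G.IsHomogeneousNorm r) (hφ : ContinuousOn φ (Set.Ici 0))
    (hb : Continuous b) (hf : Continuous f) (hl : ContinuousOn l (Set.Ici 0))
    (hu : G.IsLipLoc r u) (hU : G.IsWeakGrad u U) (γ : ℝ) :
    IsLocEssBdd (G.energy φ b f l u U γ) := by
  have huc := hu.continuous hr
  have hX := hU.isLocEssBdd_horNorm hr hu
  have hX0 := G.horNorm_nonneg U
  have hv : Continuous fun x => max (u x - γ) 0 := by fun_prop
  exact (((IsLocEssBdd.of_continuous (hv.const_mul 2)).mul (hX.comp hφ hX0)).mul hX).add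
    (((IsLocEssBdd.of_continuous (hb.mul (hf.comp huc))).mul (hX.comp hl hX0)).mul
      (.of_continuous (hv.pow 2)))

/-- Testing the inequality with `ζ v²`. -/
theorem integral_mul_energy_le (hr : G.IsHomogeneousNorm r) (hφ : ContinuousOn φ (Set.Ici 0))
    (hφ0 : ∀ t, 0 ≤ t → 0 ≤ φ t)
    (hb : Continuous b) (hf : Continuous f) (hl : ContinuousOn l (Set.Ici 0))
    (hu : G.IsLipLoc r u) (hU : G.IsWeakGrad u U)
    (hsol : ∀ ψ Ψ, G.IsLipCompact r ψ → (∀ x, 0 ≤ ψ x) → G.IsWeakGrad ψ Ψ →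
      ∫ x, φ (G.horNorm U x) / G.horNorm U x * G.horInner U Ψ x
        ≤ - ∫ x, b x * f (u x) * l (G.horNorm U x) * ψ x)
    (γ : ℝ) {ζ : (Fin n → ℝ) → ℝ} (hζ : ContDiff ℝ ∞ ζ) (hζc : HasCompactSupport ζ)
    (hζ0 : ∀ x, 0 ≤ ζ x) :
    ∫ x, ζ x * G.energy φ b f l u U γ x ≤
      ∫ x, max (u x - γ) 0 ^ 2 * φ (G.horNorm U x) * ∑ j, |fderiv ℝ ζ x (G.X j x)| := by
  have huc := hu.continuous hr
  have hXb := hU.isLocEssBdd_horNorm hr hu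
  have hX0 := G.horNorm_nonneg U
  have hφX := hXb.comp hφ hX0
  have hv : Continuous fun x => max (u x - γ) 0 := by fun_prop
  have hXζ : ∀ j, Continuous fun x => fderiv ℝ ζ x (G.X j x) := fun j =>
    (hζ.continuous_fderiv (by simp)).clm_apply (G.contDiff_X j).continuous
  have hζz : ∀ x, x ∉ tsupport ζ → ζ x = 0 := fun x hx => image_eq_zero_of_notMem_tsupport hx
  have hdz : ∀ x, x ∉ tsupport ζ → fderiv ℝ ζ x = 0 := fun x hx => by
    by_contra hne
    exact hx (support_fderiv_subset ℝ hne)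
  -- The test function `ζ v²` and its horizontal gradient.
  have hlip : G.IsLipLoc r fun x => ζ x * max (u x - γ) 0 ^ 2 := by
    simpa only [sq] using (isLipLoc_of_contDiff hr hζ).mul hr
      ((hu.max_sub hr γ).mul hr (hu.max_sub hr γ))
  have hcs : HasCompactSupport fun x => ζ x * max (u x - γ) 0 ^ 2 := hζc.mul_right
  have h := hsol _ _ ⟨hlip.isLipOn_univ hr hcs, hcs⟩
    (fun x => mul_nonneg (hζ0 x) (sq_nonneg _))
    (fun j => ((hU j).sq_max_sub hr hu γ).smooth_mul hζ)
  have hQ : ∀ j, IsLocEssBdd fun x => φ (G.horNorm U x) / G.horNorm U x * U j x := by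
    intro j
    refine ⟨(hφX.1.div₀ hXb.1).mul (hU.isLocEssBdd hr hu j).1, fun K hK => ?_⟩
    obtain ⟨M, hM⟩ := hφX.2 K hK
    refine ⟨M, ?_⟩
    filter_upwards [hM] with x hx hxK
    refine le_trans ?_ (hx hxK)
    rw [div_mul_eq_mul_div, abs_div, abs_mul, abs_of_nonneg (hX0 x)]
    exact div_le_of_le_mul₀ (hX0 x) (abs_nonneg _)
      (mul_le_mul_of_nonneg_left (G.abs_le_horNorm U j x) (abs_nonneg _))
  have i1 : Integrable fun x =>
      ζ x * (2 * max (u x - γ) 0) * φ (G.horNorm U x) * G.horNorm U x :=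
    (((IsLocEssBdd.of_continuous (hζ.continuous.mul (hv.const_mul 2))).mul hφX).mul
      hXb).integrable hζc.isCompact fun x hx => by simp [hζz x hx]
  have i2 : Integrable fun x => max (u x - γ) 0 ^ 2 *
      ∑ j, φ (G.horNorm U x) / G.horNorm U x * U j x * fderiv ℝ ζ x (G.X j x) :=
    ((IsLocEssBdd.of_continuous (hv.pow 2)).mul (IsLocEssBdd.sum _ fun j =>
      (hQ j).mul (.of_continuous (hXζ j)))).integrable hζc.isCompact fun x hx => by
        simp [hdz x hx]
  have i3 : Integrable fun x =>
      b x * f (u x) * l (G.horNorm U x) * (ζ x * max (u x - γ) 0 ^ 2) :=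
    (((IsLocEssBdd.of_continuous (hb.mul (hf.comp huc))).mul (hXb.comp hl hX0)).mul
      (.of_continuous (hζ.continuous.mul (hv.pow 2)))).integrable hζc.isCompact fun x hx => by
        simp [hζz x hx]
  have i4 : Integrable fun x =>
      max (u x - γ) 0 ^ 2 * φ (G.horNorm U x) * ∑ j, |fderiv ℝ ζ x (G.X j x)| :=
    (((IsLocEssBdd.of_continuous (hv.pow 2)).mul hφX).mul (.of_continuous
      (continuous_finsetSum _ fun j _ => (hXζ j).abs))).integrable hζc.isCompact fun x hx => by
        simp [hdz x hx]
  have e1 : ∀ x, φ (G.horNorm U x) / G.horNorm U x * G.horInner U (fun j x =>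
      ζ x * (2 * max (u x - γ) 0 * U j x) + fderiv ℝ ζ x (G.X j x) * max (u x - γ) 0 ^ 2) x =
      ζ x * (2 * max (u x - γ) 0) * φ (G.horNorm U x) * G.horNorm U x +
      max (u x - γ) 0 ^ 2 *
        ∑ j, φ (G.horNorm U x) / G.horNorm U x * U j x * fderiv ℝ ζ x (G.X j x) := by
    intro x
    have e2 : φ (G.horNorm U x) * G.horNorm U x =
        φ (G.horNorm U x) / G.horNorm U x * ∑ j, U j x ^ 2 := by
      rw [sum_sq_eq_horNorm_sq]
      rcases (hX0 x).eq_or_lt with h0 | h0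
      · simp [← h0]
      · field_simp
    rw [mul_assoc _ (φ _), e2]
    simp only [horInner, Finset.mul_sum, ← Finset.sum_add_distrib]
    refine Finset.sum_congr rfl fun j _ => ?_
    ring
  simp only [e1] at h
  rw [integral_add i1 i2] at h
  have e3 : ∫ x, ζ x * G.energy φ b f l u U γ x =
      (∫ x, ζ x * (2 * max (u x - γ) 0) * φ (G.horNorm U x) * G.horNorm U x) +
      ∫ x, b x * f (u x) * l (G.horNorm U x) * (ζ x * max (u x - γ) 0 ^ 2) := by
    rw [← integral_add i1 i3]
    congr 1; ext x; simp only [energy]; ring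
  have h4 : - ∫ x, max (u x - γ) 0 ^ 2 *
      ∑ j, φ (G.horNorm U x) / G.horNorm U x * U j x * fderiv ℝ ζ x (G.X j x) ≤
      ∫ x, max (u x - γ) 0 ^ 2 * φ (G.horNorm U x) * ∑ j, |fderiv ℝ ζ x (G.X j x)| := by
    rw [← integral_neg]
    refine integral_mono i2.neg i4 fun x => ?_
    simp only
    rw [mul_assoc, ← mul_neg]
    refine mul_le_mul_of_nonneg_left ?_ (sq_nonneg _)
    rw [Finset.mul_sum, ← Finset.sum_neg_distrib]
    refine Finset.sum_le_sum fun j _ => (neg_le_abs _).trans ?_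
    rw [abs_mul]
    refine mul_le_mul_of_nonneg_right ?_ (abs_nonneg _)
    rw [div_mul_eq_mul_div, abs_div, abs_mul, abs_of_nonneg (hX0 x),
      abs_of_nonneg (hφ0 _ (hX0 x))]
    exact div_le_of_le_mul₀ (hX0 x) (hφ0 _ (hX0 x))
      (mul_le_mul_of_nonneg_left (G.abs_le_horNorm U j x) (hφ0 _ (hX0 x)))
  linarith

end

/-! ### Decay of the energy and its vanishing -/

theorem energy_nonneg {φ : ℝ → ℝ} {b : (Fin n → ℝ) → ℝ} {f l : ℝ → ℝ} {u : (Fin n → ℝ) → ℝ}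
    {U : G.Hor → (Fin n → ℝ) → ℝ} {γ : ℝ} (hφ0 : ∀ t, 0 ≤ t → 0 ≤ φ t)
    (hb_pos : ∀ x, 0 < b x) (hl0 : ∀ t, 0 ≤ t → 0 ≤ l t) (hfγ : ∀ x, γ < u x → 0 ≤ f (u x))
    (x : Fin n → ℝ) : 0 ≤ G.energy φ b f l u U γ x := by
  have hX0 := G.horNorm_nonneg U x
  have h1 := hφ0 _ hX0
  have h2 := hl0 _ hX0
  have hv0 : 0 ≤ max (u x - γ) 0 := le_max_right _ _
  rcases le_or_gt (u x) γ with h | h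
  · rw [energy, max_eq_right (by linarith)]; simp
  · have h3 := hfγ x h
    have h4 := (hb_pos x).le
    rw [energy]; positivity

/-- On an annulus of radii comparable to `R`, the weight `(1 + r)^(-μ)` is comparable to `R^(-μ)`,
whatever the sign of `μ`. -/
theorem exists_rpow_le (μ : ℝ) {c : ℝ} (hc : 1 < c) :
    ∃ κ : ℝ, 0 < κ ∧ ∀ R ρ : ℝ, 1 ≤ R → R ≤ ρ → ρ ≤ c * R → κ * R ^ (-μ) ≤ (1 + ρ) ^ (-μ) := by
  refine ⟨min 1 ((1 + c) ^ (-μ)), by positivity, fun R ρ hR h1 h2 => ?_⟩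
  have hR0 : 0 < R := by linarith
  have h3 : 1 ≤ (1 + ρ) / R := by rw [le_div_iff₀ hR0]; linarith
  have h4 : (1 + ρ) / R ≤ 1 + c := by rw [div_le_iff₀ hR0]; linarith
  have e : (1 + ρ) ^ (-μ) = ((1 + ρ) / R) ^ (-μ) * R ^ (-μ) := by
    rw [← Real.mul_rpow (by linarith) hR0.le, div_mul_cancel₀ _ hR0.ne']
  rw [e]
  refine mul_le_mul_of_nonneg_right ?_ (by positivity)
  rcases le_total 0 (-μ) with h | h
  · exact (min_le_left _ _).trans (Real.one_le_rpow h3 h)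
  · exact (min_le_right _ _).trans (Real.rpow_le_rpow_of_nonpos (by linarith) h4 h)

/-- The growth condition `u₊ = o(r^σ)` bounds the truncation `(u - γ)₊` uniformly on large
annuli; the level `γ` does not matter as `σ > 0`. -/
theorem exists_max_sub_le {u : (Fin n → ℝ) → ℝ} {σ c δ : ℝ} (γ : ℝ) (hσ : 0 < σ) (hc : 1 < c)
    (hδ : 0 < δ) (h : (fun x => max (u x) 0) =o[comap r atTop] fun x => r x ^ σ) :
    ∃ R₀ : ℝ, 1 ≤ R₀ ∧ ∀ R, R₀ ≤ R → ∀ x, R ≤ r x → r x ≤ c * R →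
      max (u x - γ) 0 ≤ δ * R ^ σ := by
  have hc0 : 0 < c := by linarith
  have h1 := Asymptotics.isLittleO_iff.1 h (c := δ / 2 / c ^ σ) (by positivity)
  rw [eventually_comap] at h1
  obtain ⟨R₁, hR₁⟩ := eventually_atTop.1 h1
  obtain ⟨R₂, hR₂⟩ := eventually_atTop.1
    ((tendsto_rpow_atTop hσ).eventually_ge_atTop (|γ| / (δ / 2)))
  refine ⟨max 1 (max R₁ R₂), le_max_left _ _, fun R hR x hx1 hx2 => ?_⟩
  have hR1 : 1 ≤ R := (le_max_left _ _).trans hR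
  have hR0 : 0 < R := by linarith
  have hr0 : 0 < r x := by linarith
  have h2 := hR₁ (r x) (((le_max_left _ _).trans (le_max_right _ _)).trans (hR.trans hx1)) x rfl
  have h3 := hR₂ R (((le_max_right _ _).trans (le_max_right _ _)).trans hR)
  rw [div_le_iff₀ (by positivity)] at h3
  rw [Real.norm_of_nonneg (le_max_right _ _), Real.norm_of_nonneg (by positivity)] at h2
  have h4 : r x ^ σ ≤ c ^ σ * R ^ σ := by
    rw [← Real.mul_rpow hc0.le hR0.le]
    exact Real.rpow_le_rpow hr0.le hx2 hσ.le
  have h5 : max (u x) 0 ≤ δ / 2 * R ^ σ := by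
    calc max (u x) 0 ≤ δ / 2 / c ^ σ * r x ^ σ := h2
      _ ≤ δ / 2 / c ^ σ * (c ^ σ * R ^ σ) := by gcongr
      _ = _ := by field_simp
  refine max_le ?_ (by positivity)
  have := le_max_left (u x) 0
  have := neg_abs_le γ
  linarith

/-- The maximum principle behind both the boundedness of `u` and the sign of `f (sup u)`: if
`f (u)` is bounded below by a positive constant where `u > γ`, then `u > γ` nowhere. -/
theorem le_of_isWeakSolGE (hr : G.IsHomogeneousNorm r)
    {φ : ℝ → ℝ} {b : (Fin n → ℝ) → ℝ} {f l : ℝ → ℝ} {p χ μ C κ γ : ℝ}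
    (hp : 1 < p) (hφ_cont : ContinuousOn φ (Set.Ici 0)) (hφ_zero : φ 0 = 0)
    (hφ_pos : ∀ t, 0 < t → 0 < φ t)
    (hφ_le : ∃ C₀ : ℝ, 0 < C₀ ∧ ∀ t, 0 < t → φ t ≤ C₀ * t ^ (p - 1))
    (hb_cont : Continuous b) (hb_pos : ∀ x, 0 < b x) (hf_cont : Continuous f)
    (hl_cont : ContinuousOn l (Set.Ici 0)) (hl_pos : ∀ t, 0 < t → 0 < l t)
    (hχ_lt : χ < p - 1) (hμ : μ < p - χ) (hC : 0 < C)
    (hb : ∀ x, C * (1 + r x) ^ (-μ) ≤ b x)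
    (hl : ∀ t, 0 < t → C * (φ t / t ^ (p - 1 - χ)) ≤ l t)
    {u : (Fin n → ℝ) → ℝ} (hu : G.IsLipLoc r u) (hu_nonconst : ¬ ∃ c, ∀ x, u x = c)
    (hsol : G.IsWeakSolGE r φ b f l u)
    (hgrowth : (fun x => max (u x) 0) =o[comap r atTop]
        (fun x => r x ^ ((p - χ - μ) / (p - χ - 1))))
    (hκ : 0 < κ) (hfγ : ∀ x, γ < u x → κ ≤ f (u x)) (x : Fin n → ℝ) : u x ≤ γ := by
  obtain ⟨U, hU, hsol⟩ := hsol
  obtain ⟨C₀, hC₀, hφ_le⟩ := hφ_le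
  have hX0 := G.horNorm_nonneg U
  have hv0 : ∀ x, 0 ≤ max (u x - γ) 0 := fun x => le_max_right _ _
  have hφ0 : ∀ t, 0 ≤ t → 0 ≤ φ t := fun t ht => by
    rcases ht.eq_or_lt with h | h
    · rw [← h, hφ_zero]
    · exact (hφ_pos t h).le
  have hl0 : ∀ t, 0 ≤ t → 0 ≤ l t := fun t ht => by
    rcases ht.eq_or_lt with h | h
    · have h1 : Tendsto l (𝓝[>] 0) (𝓝 (l 0)) :=
        (hl_cont 0 Set.self_mem_Ici).mono_left (nhdsWithin_mono _ Set.Ioi_subset_Ici_self)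
      rw [← h]
      exact ge_of_tendsto h1 (by
        filter_upwards [self_mem_nhdsWithin] with t ht using (hl_pos t ht).le)
    · exact (hl_pos t h).le
  have hφ_le0 : ∀ t, 0 ≤ t → φ t ≤ C₀ * t ^ (p - 1) := fun t ht => by
    rcases ht.eq_or_lt with h | h
    · rw [← h, hφ_zero]; positivity
    · exact hφ_le t h
  set E := G.energy φ b f l u U γ with hE
  have hE0 : ∀ x, 0 ≤ E x :=
    energy_nonneg hφ0 hb_pos hl0 fun x hx => hκ.le.trans (hfγ x hx)
  have hEb : IsLocEssBdd E := isLocEssBdd_energy hr hφ_cont hb_cont hf_cont hl_cont hu hU γ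
  have hball := hr.isCompact_le
  have hs : 0 < p - 1 - χ := by linarith
  have hσ : 0 < (p - χ - μ) / (p - χ - 1) := div_pos (by linarith) (by linarith)
  have hσe : (1 + (p - 1 - χ) - μ) / (p - 1 - χ) = (p - χ - μ) / (p - χ - 1) := by
    congr 1 <;> ring
  set σ := (p - χ - μ) / (p - χ - 1)
  obtain ⟨c, A, hc, hA, hcut⟩ := exists_cutoff hr
  have hc0 : 0 < c := by linarith
  obtain ⟨q, hq⟩ := exists_nat_ge p
  have ha : 0 < ((q : ℝ) + 1) * A := by positivity
  set a := ((q : ℝ) + 1) * A with ha_def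
  let J : ℝ → ℝ := fun R => ∫ x in {x | r x ≤ R}, E x
  have hJ0 : ∀ R, 0 ≤ J R := fun R => integral_nonneg hE0
  -- The tested inequality with the cutoff `η ^ (q + 1)`.
  have htest : ∀ R : ℝ, 0 < R → ∃ η : (Fin n → ℝ) → ℝ,
      (∀ x, 0 ≤ η x) ∧ (∀ x, η x ≤ 1) ∧
      Integrable (fun x => η x ^ (q + 1) * E x) ∧ J R ≤ ∫ x, η x ^ (q + 1) * E x ∧
      ∃ S : (Fin n → ℝ) → ℝ, (∀ x, 0 ≤ S x) ∧
        (∀ x, S x ≤ a * η x ^ q * max (u x - γ) 0 ^ 2 * φ (G.horNorm U x) / R) ∧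
        (∀ x, S x ≠ 0 → R ≤ r x ∧ r x ≤ c * R) ∧
        ∫ x, η x ^ (q + 1) * E x ≤ ∫ x, S x := by
    intro R hR
    obtain ⟨η, hη, hη0, hη1, hone, hzero, hgrad, hann⟩ := hcut R hR
    have hζ : ContDiff ℝ ∞ fun x => η x ^ (q + 1) := hη.pow _
    have hζz : ∀ x, x ∉ {x | r x ≤ c * R} → η x ^ (q + 1) = 0 := fun x hx => by
      rw [hzero x (not_le.1 hx), zero_pow (Nat.succ_ne_zero q)]
    have hζc : HasCompactSupport fun x => η x ^ (q + 1) :=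
      HasCompactSupport.intro (hball (c * R)) hζz
    have hint : Integrable fun x => η x ^ (q + 1) * E x :=
      ((IsLocEssBdd.of_continuous hζ.continuous).mul hEb).integrable (hball (c * R))
        fun x hx => by rw [hζz x hx, zero_mul]
    have hd : ∀ x, ∑ j, |fderiv ℝ (fun x => η x ^ (q + 1)) x (G.X j x)| =
        (q + 1) * η x ^ q * ∑ j, |fderiv ℝ η x (G.X j x)| := by
      intro x
      have h1 := (hη.differentiable (by simp) x).hasFDerivAt.pow (q + 1)
      rw [Finset.mul_sum]
      refine Finset.sum_congr rfl fun j _ => ?_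
      rw [h1.fderiv]
      have := hη0 x
      simp only [Nat.add_sub_cancel, _root_.smul_apply, smul_eq_mul, abs_mul,
        nsmul_eq_mul, Nat.cast_add, Nat.cast_one]
      rw [abs_of_nonneg (by positivity : (0 : ℝ) ≤ q + 1),
        abs_of_nonneg (by positivity : 0 ≤ η x ^ q)]
    refine ⟨η, hη0, hη1, hint, ?_, _, ?_, ?_, ?_,
      integral_mul_energy_le hr hφ_cont hφ0 hb_cont hf_cont hl_cont hu hU hsol γ hζ hζc
        fun x => pow_nonneg (hη0 x) _⟩
    · calc J R = ∫ x in {x | r x ≤ R}, η x ^ (q + 1) * E x :=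
            setIntegral_congr_fun (hball R).measurableSet fun x hx => by
              simp only [hone x hx, one_pow, one_mul]
        _ ≤ _ := setIntegral_le_integral hint
            (Eventually.of_forall fun x => mul_nonneg (pow_nonneg (hη0 x) _) (hE0 x))
    · intro x
      have := hφ0 _ (hX0 x)
      positivity
    · intro x
      rw [hd]
      have h1 := hφ0 _ (hX0 x)
      have h2 := hη0 x
      calc max (u x - γ) 0 ^ 2 * φ (G.horNorm U x) *
            ((q + 1) * η x ^ q * ∑ j, |fderiv ℝ η x (G.X j x)|)
          ≤ max (u x - γ) 0 ^ 2 * φ (G.horNorm U x) * ((q + 1) * η x ^ q * (A / R)) := by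
            gcongr; exact hgrad x
        _ = _ := by rw [ha_def]; ring
    · intro x hx
      refine hann x fun h0 => hx ?_
      rw [hd, h0]; simp
  -- The energy in a ball is a small fraction of the energy in a larger ball.
  have hdecay : ∀ θ : ℝ, 0 < θ → ∃ R₀ : ℝ, 1 ≤ R₀ ∧ ∀ R, R₀ ≤ R → J R ≤ θ * J (c * R) := by
    intro θ hθ
    obtain ⟨κ₁, hκ₁, hw⟩ := exists_rpow_le μ hc
    obtain ⟨δ, hδ, habs⟩ := exists_absorb (μ := μ) (κ := C * κ₁ * κ * C) hs (by positivity) ha hθ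
    rw [hσe] at habs
    obtain ⟨R₀, hR₀, hv⟩ := exists_max_sub_le γ hσ hc hδ hgrowth
    refine ⟨R₀, hR₀, fun R hR => ?_⟩
    have hR1 : 1 ≤ R := hR₀.trans hR
    have hR0 : 0 < R := by linarith
    obtain ⟨η, hη0, hη1, -, hJR, S, hS0, hS, hSann, hES⟩ := htest R hR0
    refine (hJR.trans hES).trans ?_
    have hi : Integrable (({x | r x ≤ c * R} : Set (Fin n → ℝ)).indicator fun x => θ * E x) :=
      (integrable_indicator_iff (hball _).measurableSet).2
        ((hEb.integrableOn (hball _)).const_mul θ)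
    have hle : ∫ x, S x ≤ ∫ x, ({x | r x ≤ c * R} : Set (Fin n → ℝ)).indicator
        (fun x => θ * E x) x := by
      refine integral_mono_of_nonneg (Eventually.of_forall hS0) hi
        (Eventually.of_forall fun x => ?_)
      by_cases hSx : S x = 0
      · rw [hSx]
        exact Set.indicator_nonneg (fun x _ => mul_nonneg hθ.le (hE0 x)) x
      obtain ⟨h1, h2⟩ := hSann x hSx
      rw [Set.indicator_of_mem (show x ∈ {x | r x ≤ c * R} from h2)]
      refine (hS x).trans ?_
      have hΦ := hφ0 _ (hX0 x)
      have hstep : a * η x ^ q * max (u x - γ) 0 ^ 2 * φ (G.horNorm U x) / R ≤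
          a * max (u x - γ) 0 ^ 2 * φ (G.horNorm U x) / R := by
        have := pow_le_one₀ (n := q) (hη0 x) (hη1 x)
        have := hη0 x
        gcongr
        exact mul_le_of_le_one_right ha.le (by assumption)
      refine hstep.trans ?_
      rcases (hX0 x).eq_or_lt with hX | hX
      · rw [← hX, hφ_zero]
        simpa using mul_nonneg hθ.le (hE0 x)
      rcases le_or_gt (u x) γ with hux | hux
      · rw [max_eq_right (by linarith)]
        simpa using mul_nonneg hθ.le (hE0 x)
      refine habs R _ _ _ _ hR1 (hv0 x) (hv R hR x h1 h2) hX hΦ ?_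
      have hlx := hl _ hX
      have hbx := hb x
      have hfx := hfγ x hux
      have hwx := hw R (r x) hR1 h1 h2
      have hQ : 0 ≤ φ (G.horNorm U x) / G.horNorm U x ^ (p - 1 - χ) := by positivity
      have hRμ : 0 < R ^ (-μ) := Real.rpow_pos_of_pos hR0 _
      calc C * κ₁ * κ * C * R ^ (-μ) * (φ (G.horNorm U x) / G.horNorm U x ^ (p - 1 - χ))
          = C * (κ₁ * R ^ (-μ)) * κ *
            (C * (φ (G.horNorm U x) / G.horNorm U x ^ (p - 1 - χ))) := by ring
        _ ≤ C * (1 + r x) ^ (-μ) * κ * l (G.horNorm U x) := by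
            have := hr.nonneg x
            gcongr
        _ ≤ b x * f (u x) * l (G.horNorm U x) := by
            have := (hb_pos x).le
            have := (hl_pos _ hX).le
            gcongr
    refine hle.trans (le_of_eq ?_)
    rw [integral_indicator (hball _).measurableSet, integral_const_mul]
  -- The energy has polynomial growth.
  obtain ⟨V, D, hV, hvol⟩ := hr.exists_volume_le
  obtain ⟨R₁, hR₁, hv1⟩ := exists_max_sub_le γ hσ hc one_pos hgrowth
  obtain ⟨K, N, hpoly⟩ : ∃ K N : ℝ, ∀ R, R₁ ≤ R → J R ≤ K * R ^ N := by
    refine ⟨2 * (a * C₀ * a ^ (p - 1)) * (V * c ^ D), σ * 2 + σ * (p - 1) + D, fun R hR => ?_⟩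
    have hR1 : 1 ≤ R := hR₁.trans hR
    have hR0 : 0 < R := by linarith
    obtain ⟨η, hη0, hη1, hint, hJR, S, hS0, hS, hSann, hES⟩ := htest R hR0
    refine hJR.trans ?_
    set P : ℝ := a * C₀ * (R ^ σ) ^ 2 * (a * R ^ σ) ^ (p - 1)
    have hP : 0 ≤ P := by positivity
    have hi : Integrable (({x | r x ≤ c * R} : Set (Fin n → ℝ)).indicator fun _ => P) :=
      (integrable_indicator_iff (hball _).measurableSet).2
        (integrableOn_const (hball _).measure_lt_top.ne)
    have hi2 : Integrable fun x => η x ^ (q + 1) * E x / 2 := hint.div_const 2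
    have hle : ∫ x, S x ≤ ∫ x, (η x ^ (q + 1) * E x / 2 +
        ({x | r x ≤ c * R} : Set (Fin n → ℝ)).indicator (fun _ => P) x) := by
      refine integral_mono_of_nonneg (Eventually.of_forall hS0) (hi2.add hi)
        (Eventually.of_forall fun x => ?_)
      have hEx : 0 ≤ η x ^ (q + 1) * E x := mul_nonneg (pow_nonneg (hη0 x) _) (hE0 x)
      by_cases hSx : S x = 0
      · rw [hSx]
        exact add_nonneg (by positivity) (Set.indicator_nonneg (fun x _ => hP) x)
      obtain ⟨h1, h2⟩ := hSann x hSx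
      simp only
      rw [Set.indicator_of_mem (show x ∈ {x | r x ≤ c * R} from h2)]
      have hΦ := hφ0 _ (hX0 x)
      have hvx := hv1 R hR x h1 h2
      rw [one_mul] at hvx
      have h3 := le_add_of_rpow_le (q := q) hp (by linarith) hC₀ ha (hη0 x) (hη1 x) hR1 (hv0 x)
        (hX0 x) hΦ (hφ_le0 _ (hX0 x))
      refine ((hS x).trans h3).trans (add_le_add ?_ ?_)
      · have hsecond : 0 ≤ b x * f (u x) * l (G.horNorm U x) * max (u x - γ) 0 ^ 2 := by
          rcases le_or_gt (u x) γ with hux | hux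
          · rw [max_eq_right (by linarith)]; simp
          · have := (hb_pos x).le
            have := hl0 _ (hX0 x)
            have := hκ.le.trans (hfγ x hux)
            positivity
        have : 2 * (max (u x - γ) 0 * φ (G.horNorm U x) * G.horNorm U x) ≤ E x := by
          rw [hE, energy]; linarith
        rw [mul_div_assoc]
        exact mul_le_mul_of_nonneg_left (by linarith) (pow_nonneg (hη0 x) _)
      · have := hv0 x
        have : 0 ≤ p - 1 := by linarith
        simp only [P]
        gcongr
    have h1 := hES.trans hle
    rw [integral_add hi2 hi, integral_div, integral_indicator (hball _).measurableSet,
      setIntegral_const, smul_eq_mul] at h1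
    have h2 := hvol (c * R) (by nlinarith)
    have h3 : ∫ x, η x ^ (q + 1) * E x ≤ 2 * (V * (c * R) ^ D * P) := by
      have := mul_le_mul_of_nonneg_right h2 hP
      linarith
    refine h3.trans (le_of_eq ?_)
    simp only [P]
    rw [Real.mul_rpow ha.le (by positivity), Real.rpow_add hR0, Real.rpow_add hR0,
      Real.rpow_natCast, Real.rpow_mul hR0.le, Real.rpow_mul hR0.le, Real.rpow_two, mul_pow]
    ring
  -- Hence it vanishes, and `v²` has vanishing horizontal gradient.
  obtain ⟨R₂, hR₂, hit⟩ := hdecay (2 * c ^ N)⁻¹ (by positivity)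
  have hJ : ∀ R, max R₁ R₂ ≤ R → J R = 0 := fun R hR =>
    eq_zero_of_le_mul_of_le_rpow hc (hR₁.trans (le_max_left _ _)) hJ0
      (fun R hR => hpoly R ((le_max_left _ _).trans hR))
      (fun R hR => hit R ((le_max_right _ _).trans hR)) hR
  have hEae : ∀ᵐ x, E x = 0 := by
    have h1 : ∀ k : ℕ, ∀ᵐ x, r x ≤ max R₁ R₂ + k → E x = 0 := fun k => by
      have h2 := (setIntegral_eq_zero_iff_of_nonneg_ae (Eventually.of_forall hE0)
        (hEb.integrableOn (hball (max R₁ R₂ + k)))).1 (hJ _ (by simp))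
      exact (ae_restrict_iff' (hball _).measurableSet).1 h2
    filter_upwards [ae_all_iff.2 h1] with x hx
    obtain ⟨k, hk⟩ := exists_nat_ge (r x - max R₁ R₂)
    exact hx k (by linarith)
  have hvU : ∀ᵐ x, ∀ j, 2 * max (u x - γ) 0 * U j x = 0 := by
    filter_upwards [hEae] with x hx j
    rcases le_or_gt (u x) γ with hux | hux
    · rw [max_eq_right (by linarith)]; simp
    rcases (hX0 x).eq_or_lt with hX | hX
    · have := G.abs_le_horNorm U j x
      rw [← hX, abs_nonpos_iff] at this
      rw [this, mul_zero]
    have h1 : 0 < max (u x - γ) 0 := lt_max_of_lt_left (by linarith)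
    have h2 := hφ_pos _ hX
    have h3 := hb_pos x
    have h4 := hl_pos _ hX
    have h5 := hκ.trans_le (hfγ x hux)
    have : 0 < E x := by rw [hE, energy]; positivity
    exact absurd hx this.ne'
  have hconst : ∀ x, max (u x - γ) 0 ^ 2 = max (u 0 - γ) 0 ^ 2 := by
    refine eq_of_isWeakDeriv_zero hr (v := fun x => max (u x - γ) 0 ^ 2)
      ((hu.max_sub hr γ).continuous hr |>.pow 2) fun j => ?_
    have h1 := (hU j).sq_max_sub hr hu γ
    refine ⟨h1.1, locallyIntegrable_zero, fun η hη hηc => ?_⟩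
    rw [h1.2.2 η hη hηc]
    congr 1
    refine integral_congr_ae ?_
    filter_upwards [hvU] with y hy
    rw [hy j]
  -- If `u > γ` somewhere, then `v` is a positive constant, so `u` is constant.
  by_contra! hux
  have hv : 0 < max (u x - γ) 0 := lt_max_of_lt_left (by linarith)
  refine hu_nonconst ⟨u x, fun y => ?_⟩
  have h1 : max (u y - γ) 0 = max (u x - γ) 0 :=
    (pow_left_inj₀ (hv0 y) hv.le two_ne_zero).1 ((hconst y).trans (hconst x).symm)
  rcases le_or_gt (u y) γ with h | h
  · rw [max_eq_right (by linarith)] at h1; linarith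
  · rw [max_eq_left (by linarith), max_eq_left (by linarith)] at h1; linarith

theorem IsWeakDeriv.neg {j : G.Hor} {u g : (Fin n → ℝ) → ℝ} (h : G.IsWeakDeriv j u g) :
    G.IsWeakDeriv j (fun x => -u x) fun x => -g x := by
  refine ⟨h.1.neg, h.2.1.neg, fun η hη hc => ?_⟩
  simp only [neg_mul, integral_neg]
  rw [h.2.2 η hη hc]

/-- Reflection `u ↦ -u` turns supersolutions into subsolutions. -/
theorem IsWeakSolLE.neg {φ : ℝ → ℝ} {b : (Fin n → ℝ) → ℝ} {f l : ℝ → ℝ} {u : (Fin n → ℝ) → ℝ}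
    (h : G.IsWeakSolLE r φ b f l u) :
    G.IsWeakSolGE r φ b (fun t => -f (-t)) l fun x => -u x := by
  obtain ⟨U, hU, h⟩ := h
  refine ⟨fun j x => -U j x, fun j => (hU j).neg, fun ψ Ψ hψ hψ0 hΨ => ?_⟩
  have h1 := h ψ Ψ hψ hψ0 hΨ
  have e1 : ∀ x, G.horNorm (fun j x => -U j x) x = G.horNorm U x := fun x => by simp [horNorm]
  have e2 : ∀ x, G.horInner (fun j x => -U j x) Ψ x = -G.horInner U Ψ x := fun x => by
    simp [horInner]
  simp only [e1, e2, neg_neg, mul_neg, neg_mul, integral_neg]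
  linarith

end CarnotGroup

theorem mainTheorem2 {n : ℕ} (G : CarnotGroup n) (r : (Fin n → ℝ) → ℝ)
    (hr : G.IsHomogeneousNorm r)
    (φ : ℝ → ℝ) (b : (Fin n → ℝ) → ℝ) (f l : ℝ → ℝ) (p χ μ C : ℝ)
    -- weak `p`-coercivity, with `p > 1`
    (hp : 1 < p) (hφ_cont : ContinuousOn φ (Set.Ici 0)) (hφ_zero : φ 0 = 0)
    (hφ_pos : ∀ t, 0 < t → 0 < φ t)
    (hφ_le : ∃ C₀ : ℝ, 0 < C₀ ∧ ∀ t, 0 < t → φ t ≤ C₀ * t ^ (p - 1))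
    (hb_cont : Continuous b) (hb_pos : ∀ x, 0 < b x)
    (hf_cont : Continuous f)
    (hl_cont : ContinuousOn l (Set.Ici 0)) (hl_pos : ∀ t, 0 < t → 0 < l t)
    -- range of the parameters
    (hχ_nonneg : 0 ≤ χ) (hχ_lt : χ < p - 1) (hμ : μ < p - χ)
    -- lower bounds
    (hC : 0 < C)
    (hb : ∀ x, C * (1 + r x) ^ (-μ) ≤ b x)
    (hf : ∀ᶠ t in atTop, C ≤ f t)
    (hl : ∀ t, 0 < t → C * (φ t / t ^ (p - 1 - χ)) ≤ l t)
    (u : (Fin n → ℝ) → ℝ) (hu : G.IsLipLoc r u) (hu_nonconst : ¬ ∃ c, ∀ x, u x = c) :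
    (G.IsWeakSolGE r φ b f l u →
      (fun x => max (u x) 0) =o[comap r atTop]
        (fun x => r x ^ ((p - χ - μ) / (p - χ - 1))) →
      BddAbove (Set.range u) ∧ f (⨆ x, u x) ≤ 0) ∧
    (G.IsWeakSolEq r φ b f l u →
      (∃ C₁ : ℝ, 0 < C₁ ∧ ∃ T : ℝ, ∀ t, T ≤ |t| → C₁ * |t| ≤ t * f t) →
      u =o[comap r atTop] (fun x => r x ^ ((p - χ - μ) / (p - χ - 1))) →
      (∃ M : ℝ, ∀ x, |u x| ≤ M) ∧ f (⨆ x, u x) ≤ 0 ∧ 0 ≤ f (⨅ x, u x)) := by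
  -- Part (1) for a general right-hand side `F` and a general function `w`; it is applied to `u`
  -- and, with `F t = -f (-t)`, to `-u`.
  have main : ∀ (F : ℝ → ℝ) (w : (Fin n → ℝ) → ℝ) (c : ℝ), Continuous F → 0 < c →
      (∀ᶠ t in atTop, c ≤ F t) → G.IsLipLoc r w → (¬ ∃ c, ∀ x, w x = c) →
      G.IsWeakSolGE r φ b F l w →
      (fun x => max (w x) 0) =o[comap r atTop]
        (fun x => r x ^ ((p - χ - μ) / (p - χ - 1))) →
      BddAbove (Set.range w) ∧ F (⨆ x, w x) ≤ 0 := by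
    intro F w c hF hc hFc hw hw_nonconst hsol hgrowth
    have key : ∀ γ κ : ℝ, 0 < κ → (∀ x, γ < w x → κ ≤ F (w x)) → ∀ x, w x ≤ γ :=
      fun γ κ hκ h => CarnotGroup.le_of_isWeakSolGE hr hp hφ_cont hφ_zero hφ_pos hφ_le hb_cont
        hb_pos hF hl_cont hl_pos hχ_lt hμ hC hb hl hw hw_nonconst hsol hgrowth hκ h
    obtain ⟨γ, hγ⟩ := eventually_atTop.1 hFc
    have hbdd : BddAbove (Set.range w) :=
      ⟨γ, Set.forall_mem_range.2 (key γ c hc fun x hx => hγ _ hx.le)⟩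
    refine ⟨hbdd, ?_⟩
    by_contra! hpos
    -- By continuity `F` is bounded away from `0` on `(γ', sup w]` for some `γ' < sup w`.
    have h1 : ∀ᶠ t in 𝓝 (⨆ x, w x), F (⨆ x, w x) / 2 < F t :=
      hF.continuousAt.eventually_const_lt (half_lt_self hpos)
    obtain ⟨γ', hγ', hI⟩ := exists_Ioc_subset_of_mem_nhds h1 (exists_lt _)
    have h2 := key γ' _ (half_pos hpos) fun x hx => le_of_lt (hI ⟨hx, le_ciSup hbdd x⟩)
    exact absurd (ciSup_le h2) (not_le.2 hγ')
  refine ⟨main f u C hf_cont hC hf hu hu_nonconst, fun hsol hf2 hgrowth => ?_⟩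
  obtain ⟨C₁, hC₁, T, hT⟩ := hf2
  have hmax : ∀ w : (Fin n → ℝ) → ℝ, (∀ x, |w x| = |u x|) →
      (fun x => max (w x) 0) =o[comap r atTop]
        (fun x => r x ^ ((p - χ - μ) / (p - χ - 1))) := fun w hw => by
    refine (Asymptotics.IsBigO.of_bound 1 (Eventually.of_forall fun x => ?_)).trans_isLittleO
      hgrowth
    rw [one_mul, Real.norm_of_nonneg (le_max_right _ _), Real.norm_eq_abs, ← hw x]
    exact max_le (le_abs_self _) (abs_nonneg _)
  obtain ⟨⟨M₁, hM₁⟩, h1⟩ := main f u C hf_cont hC hf hu hu_nonconst hsol.1 (hmax u fun _ => rfl)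
  obtain ⟨⟨M₂, hM₂⟩, h2⟩ := main (fun t => -f (-t)) (fun x => -u x) C₁ (by fun_prop) hC₁
    (by
      filter_upwards [eventually_ge_atTop T, eventually_gt_atTop 0] with t ht ht0
      have h := hT (-t) (by rwa [abs_neg, abs_of_pos ht0])
      rw [abs_neg, abs_of_pos ht0] at h
      nlinarith)
    (hu.neg hr) (fun ⟨c, hc⟩ => hu_nonconst ⟨-c, fun x => by rw [← hc x, neg_neg]⟩)
    hsol.2.neg (hmax _ fun x => abs_neg _)
  refine ⟨⟨max M₁ M₂, fun x => abs_le'.2 ⟨?_, ?_⟩⟩, h1, ?_⟩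
  · exact (hM₁ ⟨x, rfl⟩).trans (le_max_left _ _)
  · exact (hM₂ ⟨x, rfl⟩).trans (le_max_right _ _)
  · have e : - ⨆ x, -u x = ⨅ x, u x := by
      rw [iInf, Real.sInf_def, ← Set.image_neg_eq_neg, ← Set.range_comp]
      rfl
    rw [e] at h2
    linarith
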